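/- Let $p$ be a prime and $G$ a finite abelian group. For $n\ge 0$ put $R_n=\mathbb{Z}_p[[X_1,\dots,X_n]]$, and let $R=\varprojlim_n R_n=\mathbb{Z}_p[[X_1,X_2,\dots]]$, the limit being taken over the surjective maps $R_{n+1}\to R_n$ that send $X_{n+1}$ to $0$ and fix the other variables. Thus $R$ consists of all formal sums $\sum_d c_d X^d$ with $c_d\in\mathbb{Z}_p$, where $X^d$ runs over all monomials in finitely many of the variables. Put $A_n=R_n[G]$ and $A=R[G]$, and let $\iota_n:A_n\to A$ be induced by the inclusion $R_n\subset R$. Definitions. For a commutative ring $B$ and a $B$-module $M$, let $M_{\rm tor}$ be the submodule of elements killed by a non-zero-divisor of $B$, and let $\mathcal{P}_B(M)$ be the set of prime ideals of $B$ of height one in the support of $M_{\rm tor}$. A finitely generated $B$-module $M$ is amenable if (a) for every prime ideal $\mathfrak{p}$ that is maximal amongst the primes contained in $\bigcup_{\mathfrak{q}\in\mathcal{P}_B(M)}\mathfrak{q}$, the ideals of $B_\mathfrak{p}$ are linearly ordered by inclusion, and (b) $\mathcal{P}_B(M)$ is finite and each prime in it is finitely generated. The ring $B$ is amenable if its total quotient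 ring is semisimple and every finitely presented torsion $B$-module is amenable. Then the following hold. (i) The rings $R$ and $R_n$, for every $n$, are $p$-adically complete (and separated) unique factorisation domains, and they are amenable. (ii) The ring $A$ is $p$-adically complete (and separated). It is the inverse limit of the rings $A_n$ under the induced surjective transition maps $A_{n+1}\to A_n$, and it is compact in the following sense: for the topology on $A_n$ given by the product of the $p$-adic topologies on the coefficients in $\mathbb{Z}_p$ of the elements $X^dg$, each $A_n$ is a compact Hausdorff topological ring and the transition maps are continuous, and with the inverse limit topology $A$ is a compact Hausdorff topological ring in which the kernel of each projection $A\to A_n$ is closed. The ring $A$ is amenable if and only if $p$ does not divide $|G|$. (iii) For every $n$ and every prime ideal $\mathfrak{p}$ of $A_n$, the ideal $\iota_n(\mathfrak{p})A$ of $A$ is prime. -/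

import Mathlib

noncomputable section

universe u v

namespace IwasawaLemma

/-! ### Amenable modules and rings -/

section Amenable

variable (A : Type u) [CommRing A]

/-- `𝒫_A(M)`: the prime ideals of height one of `A` in the support of the torsion submodule
`M_tor = {m | a • m = 0 for some non-zero-divisor a}`. -/
def heightOneTorsionSupport (M : Type v) [AddCommGroup M] [Module A M] :
    Set (PrimeSpectrum A) :=
  {q | q.asIdeal.height = 1} ∩ Module.support A (Submodule.torsion A M)

/-- A finitely generated `A`-module `M` is amenable if

* for every prime ideal `𝔭` that is maximal amongst those contained in the union of the primes in
  `𝒫_A(M)`, the ideals of the localisation `A_𝔭` are linearly ordered by inclusion;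
* `𝒫_A(M)` is finite and each of its elements is a finitely generated ideal. -/
structure IsAmenableModule (M : Type v) [AddCommGroup M] [Module A M] : Prop where
  finite : Module.Finite A M
  valuation : ∀ P : PrimeSpectrum A,
    Maximal (fun P' : PrimeSpectrum A =>
      (P'.asIdeal : Set A) ⊆ ⋃ q ∈ heightOneTorsionSupport A M, (q.asIdeal : Set A)) P →
    ∀ I J : Ideal (Localization.AtPrime P.asIdeal), I ≤ J ∨ J ≤ I
  finite_primes : (heightOneTorsionSupport A M).Finite
  fg_primes : ∀ q ∈ heightOneTorsionSupport A M, q.asIdeal.FG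

/-- A commutative ring `A` is amenable if its total quotient ring is semisimple and every finitely
presented torsion `A`-module is amenable. (Every finitely presented `A`-module is isomorphic to
one in the universe of `A`.) -/
structure IsAmenableRing : Prop where
  semisimple : IsSemisimpleRing (FractionRing A)
  amenable : ∀ (M : Type u) [AddCommGroup M] [Module A M],
    Module.FinitePresentation A M → Module.IsTorsion A M → IsAmenableModule A M

end Amenable

/-- `B` is `p`-adically complete (and separated). -/
def IsPAdicallyComplete (p : ℕ) (B : Type u) [CommRing B] : Prop :=
  IsAdicComplete (Ideal.span {(p : B)}) B

/-! ### Inverse limits of rings and compactness -/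

section InverseLimit

variable {B : ℕ → Type u} [∀ n, CommRing (B n)] {A : Type v} [CommRing A]

/-- `A`, with the projections `π n : A → B n`, is the inverse limit of the rings `B n` with respect
to the transition maps `φ n : B (n + 1) → B n`. -/
structure IsInverseLimit (φ : ∀ n, B (n + 1) →+* B n) (π : ∀ n, A →+* B n) : Prop where
  compatible : ∀ n, (φ n).comp (π (n + 1)) = π n
  existsUnique_lift : ∀ b : ∀ n, B n, (∀ n, φ n (b (n + 1)) = b n) → ∃! a : A, ∀ n, π n a = b n

/-- The topology `t` makes `A` a compact Hausdorff topological ring. -/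
structure IsCompactRingTopology (A : Type v) [CommRing A] (t : TopologicalSpace A) : Prop where
  isTopologicalRing : IsTopologicalRing A
  compactSpace : CompactSpace A
  t2Space : T2Space A

/-- The inverse limit topology on `A`: the coarsest one for which all `π n` are continuous. -/
abbrev limitTopology (τ : ∀ n, TopologicalSpace (B n)) (π : ∀ n, A →+* B n) : TopologicalSpace A :=
  ⨅ n, (τ n).induced (π n)

/-- `A` is the limit of an inverse system of rings with surjective transition maps and is compact:
each `B n` carries a compact ring topology `τ n`, the transition maps are continuous, and the
inverse limit topology on `A` is a compact ring topology for which the kernels of the projections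
are closed. -/
structure IsCompactInverseLimit (τ : ∀ n, TopologicalSpace (B n))
    (φ : ∀ n, B (n + 1) →+* B n) (π : ∀ n, A →+* B n) : Prop where
  isInverseLimit : IsInverseLimit φ π
  surjective : ∀ n, Function.Surjective (φ n)
  compact : ∀ n, IsCompactRingTopology (B n) (τ n)
  continuous : ∀ n, @Continuous _ _ (τ (n + 1)) (τ n) (φ n)
  compact_limit : IsCompactRingTopology A (limitTopology τ π)
  isClosed_ker : ∀ n, @IsClosed A (limitTopology τ π) (RingHom.ker (π n) : Set A)

end InverseLimit

/-! ### Power series rings over `ℤ_p` and their group rings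

The variable `X_{i+1}` of the usual notation is `MvPowerSeries.X i`. -/

section PowerSeries

variable (p : ℕ) [Fact p.Prime]

/-- `R_n = ℤ_p[[X_1, …, X_n]]`. -/
abbrev Rfin (n : ℕ) : Type := MvPowerSeries (Fin n) ℤ_[p]

/-- `R = ℤ_p[[X_1, X_2, …]]`: all formal sums of `ℤ_p`-multiples of monomials, each monomial
involving only finitely many variables. It is the inverse limit of the rings `R_n`, see
`isInverseLimit_Rinf`. -/
abbrev Rinf : Type := MvPowerSeries ℕ ℤ_[p]

/-- The inclusion `R_n → R`, `X_i ↦ X_i`. -/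
def inclR (n : ℕ) : Rfin p n →+* Rinf p :=
  (MvPowerSeries.rename (R := ℤ_[p]) (Fin.valEmbedding : Fin n ↪ ℕ)).toRingHom

/-- The projection `R → R_n` with `X_i ↦ X_i` for `i ≤ n` and `X_i ↦ 0` for `i > n`. -/
def projR (n : ℕ) : Rinf p →+* Rfin p n :=
  (MvPowerSeries.killCompl (R := ℤ_[p]) (Fin.valEmbedding : Fin n ↪ ℕ)).toRingHom

/-- The transition map `R_{n+1} → R_n` with `X_i ↦ X_i` for `i ≤ n` and `X_{n+1} ↦ 0`. -/
def transR (n : ℕ) : Rfin p (n + 1) →+* Rfin p n :=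
  (MvPowerSeries.killCompl (R := ℤ_[p]) (Fin.castSuccEmb : Fin n ↪ Fin (n + 1))).toRingHom

theorem isInverseLimit_Rinf : IsInverseLimit (transR p) (projR p) := by
  have htrans : ∀ n (a : Rfin p (n + 1)) (x : Fin n →₀ ℕ),
      MvPowerSeries.coeff x (transR p n a)
        = MvPowerSeries.coeff (x.embDomain Fin.castSuccEmb) a :=
    fun n a x => MvPowerSeries.coeff_killCompl a x
  have hproj : ∀ n (a : Rinf p) (x : Fin n →₀ ℕ),
      MvPowerSeries.coeff x (projR p n a)
        = MvPowerSeries.coeff (x.embDomain Fin.valEmbedding) a :=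
    fun n a x => MvPowerSeries.coeff_killCompl a x
  have hemb : ∀ n (x : Fin n →₀ ℕ),
      (x.embDomain Fin.castSuccEmb).embDomain Fin.valEmbedding
        = x.embDomain (Fin.valEmbedding : Fin n ↪ ℕ) := by
    intro n x
    simp only [Finsupp.embDomain_eq_mapDomain, ← Finsupp.mapDomain_comp]
    rfl
  refine ⟨fun n => ?_, fun b hb => ?_⟩
  · ext a x
    simp only [RingHom.comp_apply, htrans, hproj, hemb]
  · have hstep : ∀ n k (x : Fin n →₀ ℕ) (y : Fin (n + k) →₀ ℕ),
        x.embDomain (Fin.valEmbedding : Fin n ↪ ℕ) = y.embDomain Fin.valEmbedding →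
        MvPowerSeries.coeff y (b (n + k)) = MvPowerSeries.coeff x (b n) := by
      intro n k
      induction k with
      | zero =>
        intro x y h
        rw [Finsupp.embDomain_injective _ h]
        rfl
      | succ k ih =>
        intro x y h
        have hc : ∃ z : Fin (n + k) →₀ ℕ, x.embDomain (Fin.valEmbedding : Fin n ↪ ℕ)
            = z.embDomain Fin.valEmbedding := by
          refine ⟨x.embDomain (Fin.castAddEmb k), ?_⟩
          simp only [Finsupp.embDomain_eq_mapDomain, ← Finsupp.mapDomain_comp]
          rfl
        obtain ⟨z, hz⟩ := hc
        rw [← ih x z hz, ← hb (n + k), htrans]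
        congr 2
        apply Finsupp.embDomain_injective (Fin.valEmbedding : Fin (n + k + 1) ↪ ℕ)
        rw [hemb, ← hz]
        exact h.symm
    have hstep' : ∀ n m (x : Fin n →₀ ℕ) (y : Fin m →₀ ℕ),
        x.embDomain (Fin.valEmbedding : Fin n ↪ ℕ) = y.embDomain Fin.valEmbedding →
        MvPowerSeries.coeff y (b m) = MvPowerSeries.coeff x (b n) := by
      intro n m x y h
      rcases le_total n m with hnm | hnm
      · obtain ⟨k, rfl⟩ := Nat.exists_eq_add_of_le hnm
        exact hstep n k x y h
      · obtain ⟨k, rfl⟩ := Nat.exists_eq_add_of_le hnm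
        exact (hstep m k y x h.symm).symm
    have hex : ∀ e : ℕ →₀ ℕ, ∃ (n : ℕ) (x : Fin n →₀ ℕ),
        x.embDomain (Fin.valEmbedding : Fin n ↪ ℕ) = e := by
      intro e
      obtain ⟨N, hN⟩ := e.support.bddAbove
      refine ⟨N + 1, (Finsupp.mem_range_embDomain_iff _ _).2 fun i hi => ?_⟩
      exact ⟨⟨i, Nat.lt_succ_of_le (hN hi)⟩, rfl⟩
    choose N x hx using hex
    refine ⟨fun e => MvPowerSeries.coeff (x e) (b (N e)), fun n => ?_, fun a ha => ?_⟩
    · ext y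
      exact (hproj n _ y).trans (hstep' n (N _) y (x _) (hx _).symm)
    · ext e
      change _ = MvPowerSeries.coeff (x e) (b (N e))
      rw [← ha, hproj, hx]

variable (G : Type u) [CommGroup G]

/-- `A_n = R_n[G]`. -/
abbrev Afin (n : ℕ) : Type u := MonoidAlgebra (Rfin p n) G

/-- `A = R[G]`. -/
abbrev Ainf : Type u := MonoidAlgebra (Rinf p) G

/-- The map `ι_n : A_n → A` given by the inclusion `R_n → R` on coefficients. -/
def inclA (n : ℕ) : Afin p G n →+* Ainf p G := MonoidAlgebra.mapRingHom G (inclR p n)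

/-- The map `A → A_n` given by the projection `R → R_n` on coefficients. -/
def projA (n : ℕ) : Ainf p G →+* Afin p G n := MonoidAlgebra.mapRingHom G (projR p n)

/-- The transition map `A_{n+1} → A_n` given by `R_{n+1} → R_n` on coefficients. -/
def transA (n : ℕ) : Afin p G (n + 1) →+* Afin p G n := MonoidAlgebra.mapRingHom G (transR p n)

/-- The canonical topology on `A_n`: identifying an element with the family of coefficients in
`ℤ_p` of all `X^d g`, the product of the `p`-adic topologies. -/
abbrev topA (n : ℕ) : TopologicalSpace (Afin p G n) :=
  TopologicalSpace.induced
    (fun (a : Afin p G n) (x : G × (Fin n →₀ ℕ)) => MvPowerSeries.coeff x.2 (a.coeff x.1))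
    Pi.topologicalSpace

end PowerSeries

end IwasawaLemma

end

noncomputable section

universe u v

namespace IwasawaLemma

/-! ### Amenability reduced to primes of height one. -/

section Amenable

variable {B : Type u} [CommRing B]

/-! Unique factorisation is proved over an arbitrary complete discrete valuation ring `O`, because
Witt vectors of finite fields are needed as well as `ℤ_[p]`. In finitely many variables it goes by
induction: a coefficient of least valuation is factored out of a series, a shear `X_i ↦ X_i + X_0 ^
(D ^ i)` makes the remaining factor regular in `X_0`, and Weierstrass preparation replaces it by a
distinguished polynomial over the power series ring in one variable fewer, where Gauss's lemma
applies (`ufd_mvPowerSeries_fin`). For countably many variables, consider the images of a series in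
the rings with `n` variables. Once nonzero, their number of irreducible factors cannot grow with
`n`, so it stabilises. From then on irreducible factors reduce to irreducible factors, and a
compatible sequence of them converges to a prime factor of the series (`ufd_of_inverseLimit`).

In a finite product of unique factorisation domains, the height one primes containing a given
non-zero-divisor are finite in number and principal, and divisibility is total in their
localisations. Hence such a product is amenable (`isAmenableRing_of_ringEquiv_pi`). If `p` does not
divide `|G|`, Maschke's theorem splits `F_p[G]` into fields, the splitting lifts to an isomorphism
of `ℤ_p[G]` with a product of Witt vector rings, and `A` becomes a finite product of power series
rings over these.

If `p` divides `|G|`, let `γ` in `G` have order `p`. At the height one prime of elements whose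
augmentation is divisible by `p`, neither of `γ - 1` and `1 + γ + ⋯ + γ ^ (p - 1)` divides the
other, so amenability fails (`not_isAmenableRing_monoidAlgebra`).

For the extension of primes, `A` is a power series ring over the noetherian ring `A_n`, with `ι_n`
the inclusion of constants. A finitely generated prime extends to the kernel of a map onto power
series over a domain (`isPrime_map_C`). Completeness and compactness are read off coefficient by
coefficient. -/

/-- The ideals of `B_q` are totally ordered if and only if divisibility is total in `B` up to
factors outside `q`. -/
theorem ideal_total_localization_iff (q : Ideal B) [q.IsPrime] :
    (∀ I J : Ideal (Localization.AtPrime q), I ≤ J ∨ J ≤ I) ↔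
      ∀ x y : B, ∃ s ∉ q, ∃ c, s * x = c * y ∨ s * y = c * x := by
  have key : (∀ I J : Ideal (Localization.AtPrime q), I ≤ J ∨ J ≤ I) ↔
      ∀ a b : Localization.AtPrime q, a ∣ b ∨ b ∣ a := by
    constructor
    · intro h a b
      have := PreValuationRing.iff_ideal_total.2 ⟨h⟩
      exact ValuationRing.dvd_total a b
    · intro h
      have : PreValuationRing (Localization.AtPrime q) := PreValuationRing.iff_dvd_total.2 ⟨h⟩
      exact (PreValuationRing.iff_ideal_total.1 this).total
  have aux : ∀ x y : B, algebraMap B (Localization.AtPrime q) x ∣ algebraMap B _ y ↔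
      ∃ s ∉ q, ∃ c, s * y = c * x := by
    intro x y
    constructor
    · rintro ⟨z, hz⟩
      obtain ⟨⟨c, t⟩, ht⟩ := IsLocalization.surj q.primeCompl z
      have h1 : algebraMap B (Localization.AtPrime q) (y * t) = algebraMap B _ (x * c) := by
        rw [map_mul, map_mul, hz, ← ht, mul_assoc]
      obtain ⟨r, hr⟩ := (IsLocalization.eq_iff_exists q.primeCompl _).1 h1
      exact ⟨r * t, (r * t).2, r * c, by linear_combination hr⟩
    · rintro ⟨s, hs, c, h⟩
      have hu : IsUnit (algebraMap B (Localization.AtPrime q) s) :=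
        IsLocalization.map_units _ (⟨s, hs⟩ : q.primeCompl)
      rw [← hu.dvd_mul_left, ← map_mul, h, map_mul]
      exact Dvd.intro_left _ rfl
  rw [key]
  constructor
  · intro h x y
    rcases h (algebraMap B _ x) (algebraMap B _ y) with h | h
    · obtain ⟨s, hs, c, h⟩ := (aux _ _).1 h
      exact ⟨s, hs, c, .inr h⟩
    · obtain ⟨s, hs, c, h⟩ := (aux _ _).1 h
      exact ⟨s, hs, c, .inl h⟩
  · intro h a b
    obtain ⟨⟨x, s⟩, hx⟩ := IsLocalization.surj q.primeCompl a
    obtain ⟨⟨y, t⟩, hy⟩ := IsLocalization.surj q.primeCompl b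
    have hs : IsUnit (algebraMap B (Localization.AtPrime q) s) := IsLocalization.map_units _ s
    have ht : IsUnit (algebraMap B (Localization.AtPrime q) t) := IsLocalization.map_units _ t
    simp only at hx hy
    obtain ⟨r, hr, c, h | h⟩ := h x y
    · right
      rw [← ht.mul_right_dvd, ← hs.dvd_mul_right, hx, hy]
      exact (aux _ _).2 ⟨r, hr, c, h⟩
    · left
      rw [← hs.mul_right_dvd, ← ht.dvd_mul_right, hx, hy]
      exact (aux _ _).2 ⟨r, hr, c, h⟩

/-- Multiply together non-zero-divisors that kill the finitely many generators. -/
theorem exists_nonZeroDivisor_smul_eq_zero {M : Type v} [AddCommGroup M] [Module B M]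
    [Module.Finite B M] (hM : Module.IsTorsion B M) :
    ∃ a ∈ nonZeroDivisors B, ∀ m : M, a • m = 0 := by
  classical
  obtain ⟨s, hs⟩ := Module.Finite.fg_top (R := B) (M := M)
  choose a ha using fun m : M => @hM m
  refine ⟨∏ m ∈ s, (a m : B), prod_mem fun m _ => (a m).2, fun m => ?_⟩
  have hm : m ∈ Submodule.span B (s : Set M) := hs ▸ Submodule.mem_top
  induction hm using Submodule.span_induction with
  | mem x hx =>
    rw [← Finset.prod_erase_mul _ _ hx, mul_smul]
    have := ha x
    rw [Submonoid.smul_def] at this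
    rw [this, smul_zero]
  | zero => exact smul_zero _
  | add x y _ _ hx hy => rw [smul_add, hx, hy, add_zero]
  | smul r x _ hx => rw [smul_comm, hx, smul_zero]

/-- An amenability criterion in terms of the height one primes containing a non-zero-divisor. -/
theorem isAmenableRing_of_heightOne (hss : IsSemisimpleRing (FractionRing B))
    (hfin : ∀ a ∈ nonZeroDivisors B,
      {q : PrimeSpectrum B | q.asIdeal.height = 1 ∧ a ∈ q.asIdeal}.Finite)
    (hfg : ∀ a ∈ nonZeroDivisors B, ∀ q : PrimeSpectrum B, q.asIdeal.height = 1 →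
      a ∈ q.asIdeal → q.asIdeal.FG)
    (htot : ∀ a ∈ nonZeroDivisors B, ∀ q : PrimeSpectrum B, q.asIdeal.height = 1 →
      a ∈ q.asIdeal → ∀ I J : Ideal (Localization.AtPrime q.asIdeal), I ≤ J ∨ J ≤ I) :
    IsAmenableRing B := by
  refine ⟨hss, fun M _ _ hfp hM => ?_⟩
  have hMf : Module.Finite B M := inferInstance
  obtain ⟨a, ha, haM⟩ := exists_nonZeroDivisor_smul_eq_zero hM
  have hsub : ∀ q ∈ heightOneTorsionSupport B M, q.asIdeal.height = 1 ∧ a ∈ q.asIdeal := by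
    rintro q ⟨h1, h2⟩
    refine ⟨h1, ?_⟩
    obtain ⟨m, hm⟩ := Module.mem_support_iff_exists_annihilator.1 h2
    apply hm
    rw [Submodule.mem_annihilator_span_singleton]
    ext
    exact haM m
  have hF : (heightOneTorsionSupport B M).Finite := (hfin a ha).subset hsub
  refine ⟨hMf, fun P hP => ?_, hF, fun q hq => hfg a ha q (hsub q hq).1 (hsub q hq).2⟩
  have h := hP.prop
  -- An empty union is empty, whereas `P` contains `0`.
  have hne : (heightOneTorsionSupport B M).Nonempty := by
    by_contra hne
    rw [Set.not_nonempty_iff_eq_empty] at hne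
    simp only [hne, Set.mem_empty_iff_false, Set.iUnion_of_empty, Set.iUnion_empty] at h
    exact h P.asIdeal.zero_mem
  -- Prime avoidance puts `P` inside a single height one prime, and maximality makes them equal.
  obtain ⟨q, hq, hPq⟩ := (Ideal.subset_union_prime_finite hF
    (f := fun q : PrimeSpectrum B => q.asIdeal) hne.some hne.some
    fun q _ _ _ => q.isPrime).1 h
  have hqP : q ≤ P := hP.2 (Set.subset_biUnion_of_mem (u := fun q : PrimeSpectrum B =>
    (q.asIdeal : Set B)) hq) hPq
  obtain rfl : P = q := le_antisymm hPq hqP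
  exact htot a ha P (hsub P hq).1 (hsub P hq).2

end Amenable

/-! ### Finite products of unique factorisation domains are amenable. -/

section ProductOfUFDs

variable {B : Type u} [CommRing B] {ι : Type*} {D : ι → Type v} [∀ i, CommRing (D i)]
  [∀ i, IsDomain (D i)]

/-- If the `i`-th coordinate vanished, `a` would be killed by the `i`-th idempotent. -/
theorem nonZeroDivisors_pi_apply_ne_zero (e : B ≃+* Π i, D i) {a : B} (ha : a ∈ nonZeroDivisors B)
    (i : ι) : e a i ≠ 0 := by
  classical
  intro h
  have : e.symm (Pi.single i 1) = 0 := by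
    refine (mem_nonZeroDivisors_iff.1 ha).1 _ (e.injective ?_)
    rw [map_mul, e.apply_symm_apply, map_zero]
    ext j
    by_cases hj : j = i
    · subst hj; simp [h]
    · simp [hj]
  have := congrFun (e.symm.map_eq_zero_iff.1 this) i
  simp at this

/-- The total quotient ring is the product of the fraction fields of the factors. -/
theorem isSemisimpleRing_fractionRing_of_pi [Finite ι] (e : B ≃+* Π i, D i) :
    IsSemisimpleRing (FractionRing B) := by
  let K := Π i, FractionRing (D i)
  let _ : Algebra B K := ((algebraMap (Π i, D i) K).comp e.toRingHom).toAlgebra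
  have hK : IsFractionRing B K := by
    have h0 : IsLocalization (Submonoid.pi .univ fun i => nonZeroDivisors (D i)) K := inferInstance
    have := IsLocalization.isLocalization_of_base_ringEquiv
      (Submonoid.pi .univ fun i => nonZeroDivisors (D i)) K e.symm
    have hmap : (Submonoid.pi .univ fun i => nonZeroDivisors (D i)).map e.symm =
        nonZeroDivisors B := by
      ext a
      constructor
      · rintro ⟨b, hb, rfl⟩
        refine mem_nonZeroDivisors_iff_right.2 fun x hx => e.injective ?_
        ext i
        have h := congrFun (congrArg e hx) i
        have h' : (e x) i * b i = 0 := by simpa using h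
        simpa using (mul_eq_zero.1 h').resolve_right (nonZeroDivisors.ne_zero (hb i trivial))
      · intro ha
        exact ⟨e a, fun i _ => mem_nonZeroDivisors_of_ne_zero
          (nonZeroDivisors_pi_apply_ne_zero e ha i), e.symm_apply_apply a⟩
    rw [IsFractionRing, ← hmap]
    exact this
  have : IsSemisimpleRing K := inferInstance
  exact (IsLocalization.algEquiv (nonZeroDivisors B) K
    (FractionRing B)).toRingEquiv.isSemisimpleRing

/-- Strip off the powers of `π`: up to factors prime to `π`, both elements are powers of `π`, and
powers are comparable. -/
theorem exists_mul_eq_mul_of_prime [∀ i, UniqueFactorizationMonoid (D i)] {i : ι} {π : D i}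
    (hπ : Prime π) (x y : D i) : ∃ s, ¬ π ∣ s ∧ ∃ c, s * x = c * y ∨ s * y = c * x := by
  have h1 : ¬ π ∣ 1 := fun h => hπ.not_isUnit (isUnit_of_dvd_one h)
  by_cases hx : x = 0
  · exact ⟨1, h1, 0, .inl (by simp [hx])⟩
  by_cases hy : y = 0
  · exact ⟨1, h1, 0, .inr (by simp [hy])⟩
  obtain ⟨x', hxx, hx'⟩ := (FiniteMultiplicity.of_prime_left hπ hx).exists_eq_pow_mul_and_not_dvd
  obtain ⟨y', hyy, hy'⟩ := (FiniteMultiplicity.of_prime_left hπ hy).exists_eq_pow_mul_and_not_dvd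
  generalize multiplicity π x = a at hxx
  generalize multiplicity π y = b at hyy
  subst hxx hyy
  rcases le_total a b with h | h
  · obtain ⟨k, rfl⟩ := Nat.exists_eq_add_of_le h
    exact ⟨x', hx', π ^ k * y', .inr (by ring)⟩
  · obtain ⟨k, rfl⟩ := Nat.exists_eq_add_of_le h
    exact ⟨y', hy', π ^ k * x', .inl (by ring)⟩

/-- In a finite product of unique factorisation domains, a prime of height one which contains a
non-zero-divisor `a` is the preimage of a principal prime of one of the factors. -/
theorem exists_prime_of_height_eq_one [Finite ι] (e : B ≃+* Π i, D i) (s : ∀ i, Multiset (D i))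
    (hs : ∀ i, ∀ π ∈ s i, Prime π) {a : B} (hsa : ∀ i, Associated (s i).prod (e a i))
    (q : Ideal B) [q.IsPrime] (hq : q.height = 1) (haq : a ∈ q) :
    ∃ i, ∃ π ∈ s i, ∀ x, x ∈ q ↔ π ∣ e x i := by
  classical
  have := Fintype.ofFinite ι
  -- The coordinate idempotents sum to `1`, so one of them lies outside `q`; then `q` contains the
  -- kernel of the projection to that factor.
  obtain ⟨i, hi⟩ : ∃ i, e.symm (Pi.single i 1) ∉ q := by
    by_contra! h
    refine (Ideal.ne_top_iff_one q).1 (Ideal.IsPrime.ne_top ‹_›) ?_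
    have : (1 : B) = ∑ i, e.symm (Pi.single i 1) := by
      rw [← map_sum, ← map_one e.symm]
      congr 1
      exact (Finset.univ_sum_single (1 : Π i, D i)).symm
    rw [this]
    exact sum_mem fun i _ => h i
  let f : B →+* D i := (Pi.evalRingHom D i).comp e.toRingHom
  have hfx : ∀ x, f x = e x i := fun _ => rfl
  have hf : Function.Surjective f := fun y => ⟨e.symm (Pi.single i y), by simp [hfx]⟩
  have hker : RingHom.ker f ≤ q := by
    intro x hx
    refine (Ideal.IsPrime.mem_or_mem ‹q.IsPrime› (x := e.symm (Pi.single i 1)) ?_).resolve_left hi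
    have h0 : e.symm (Pi.single i 1) * x = 0 := by
      apply e.injective
      rw [map_mul, e.apply_symm_apply, map_zero]
      ext j
      by_cases hj : j = i
      · subst hj
        simpa [hfx] using hx
      · simp [hj]
    rw [h0]
    exact q.zero_mem
  have hq' : (q.map f).IsPrime := Ideal.map_isPrime_of_surjective hf hker
  have hcomap : (q.map f).comap f = q := by
    rw [Ideal.comap_map_of_surjective f hf]
    exact sup_eq_left.2 hker
  obtain ⟨π, hπs, hπq⟩ : ∃ π ∈ s i, π ∈ q.map f := by
    rw [← hq'.multiset_prod_mem_iff_exists_mem]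
    obtain ⟨u, hu⟩ := (hsa i).symm
    rw [← hu]
    exact Ideal.mul_mem_right _ _ (Ideal.mem_map_of_mem f haq)
  have hπ := hs i π hπs
  refine ⟨i, π, hπs, fun x => ?_⟩
  have hP1 : (Ideal.span {π}).IsPrime := (Ideal.span_singleton_prime hπ.ne_zero).2 hπ
  set P := (Ideal.span {π}).comap f with hP
  have hPq : P ≤ q := by
    rw [← hcomap]
    exact Ideal.comap_mono ((Ideal.span_singleton_le_iff_mem _).2 hπq)
  have hkP : RingHom.ker f < P := by
    refine lt_of_le_of_ne (Ideal.comap_mono bot_le) fun h => ?_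
    obtain ⟨y, hy⟩ := hf π
    have : y ∈ RingHom.ker f := by
      rw [h, hP, Ideal.mem_comap, hy]
      exact Ideal.mem_span_singleton_self π
    exact hπ.ne_zero (hy ▸ this)
  -- Otherwise `ker f < P < q` is a chain of primes of length two below a prime of height one.
  have hPe : P = q := by
    by_contra hne
    have := RingHom.ker_isPrime f
    have h1 := Ideal.height_add_one_le_of_lt_of_isPrime hkP
    have h2 := Ideal.height_add_one_le_of_lt_of_isPrime (lt_of_le_of_ne hPq hne)
    rw [hq] at h2
    have h3 : (1 : ℕ∞) + 1 ≤ 1 := (add_le_add_left (le_add_self.trans h1) 1).trans h2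
    exact absurd h3 (by decide)
  rw [← hPe, hP, Ideal.mem_comap, Ideal.mem_span_singleton, hfx]

/-- A finite product of unique factorisation domains is amenable. -/
theorem isAmenableRing_of_ringEquiv_pi [Finite ι] [∀ i, UniqueFactorizationMonoid (D i)]
    (e : B ≃+* Π i, D i) : IsAmenableRing B := by
  classical
  have hfac : ∀ a ∈ nonZeroDivisors B, ∃ s : ∀ i, Multiset (D i), (∀ i, ∀ π ∈ s i, Prime π) ∧
      ∀ i, Associated (s i).prod (e a i) := by
    intro a ha
    choose s hs hsa using fun i => UniqueFactorizationMonoid.exists_prime_factors (e a i)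
      (nonZeroDivisors_pi_apply_ne_zero e ha i)
    exact ⟨s, hs, hsa⟩
  refine isAmenableRing_of_heightOne (isSemisimpleRing_fractionRing_of_pi e)
    (fun a ha => ?_) (fun a ha q hq haq => ?_) (fun a ha q hq haq => ?_)
  · obtain ⟨s, hs, hsa⟩ := hfac a ha
    have hfin : (⋃ i, (fun π : D i => {x : B | π ∣ e x i}) '' {π | π ∈ s i}).Finite :=
      Set.finite_iUnion fun i => ((s i).finite_toSet).image _
    refine Set.Finite.of_finite_image (f := fun q : PrimeSpectrum B => (q.asIdeal : Set B))
      (hfin.subset ?_) fun q _ q' _ h => PrimeSpectrum.ext (SetLike.coe_injective h)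
    rintro _ ⟨q, ⟨hq, haq⟩, rfl⟩
    obtain ⟨i, π, hπ, h⟩ := exists_prime_of_height_eq_one e s hs hsa q.asIdeal hq haq
    exact Set.mem_iUnion.2 ⟨i, π, hπ, Set.ext fun x => (h x).symm⟩
  · obtain ⟨s, hs, hsa⟩ := hfac a ha
    obtain ⟨i, π, hπ, h⟩ := exists_prime_of_height_eq_one e s hs hsa q.asIdeal hq haq
    -- The generator has `π` in place `i` and units elsewhere.
    refine ⟨{e.symm (Function.update 1 i π)}, le_antisymm ?_ fun x hx => ?_⟩
    · rw [Finset.coe_singleton, Ideal.span_le, Set.singleton_subset_iff, SetLike.mem_coe, h]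
      simp
    · obtain ⟨c, hc⟩ := (h x).1 hx
      rw [Finset.coe_singleton]
      refine Ideal.mem_span_singleton.2 ⟨e.symm (Function.update (e x) i c), e.injective ?_⟩
      rw [map_mul, e.apply_symm_apply, e.apply_symm_apply]
      ext j
      by_cases hj : j = i
      · subst hj; simp [hc]
      · simp [hj]
  · obtain ⟨s, hs, hsa⟩ := hfac a ha
    obtain ⟨i, π, hπ, h⟩ := exists_prime_of_height_eq_one e s hs hsa q.asIdeal hq haq
    rw [ideal_total_localization_iff]
    intro x y
    obtain ⟨t, ht, c, hc⟩ := exists_mul_eq_mul_of_prime (hs i π hπ) (e x i) (e y i)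
    have haux : ∀ u v : B, t * e u i = c * e v i →
        e.symm (Pi.single i t) * u = e.symm (Pi.single i c) * v := by
      intro u v huv
      apply e.injective
      rw [map_mul, map_mul, e.apply_symm_apply, e.apply_symm_apply]
      ext j
      by_cases hj : j = i
      · subst hj; simpa using huv
      · simp [hj]
    -- Supporting both multipliers at `i` makes the equation trivial in the other coordinates, while
    -- membership in `q` only sees coordinate `i`.
    refine ⟨e.symm (Pi.single i t), ?_, e.symm (Pi.single i c), hc.imp (haux _ _) (haux _ _)⟩
    rw [h]
    simpa using ht

theorem isAmenableRing_of_ufd (B : Type u) [CommRing B] [IsDomain B]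
    [UniqueFactorizationMonoid B] : IsAmenableRing B :=
  isAmenableRing_of_ringEquiv_pi (ι := Unit) (D := fun _ => B)
    (RingEquiv.piUnique (fun _ : Unit => B)).symm

end ProductOfUFDs

/-! ### Failure of amenability when `p` divides the order of `G`. -/

section GroupRing

open MonoidAlgebra

variable {R : Type v} [CommRing R] {G : Type u} [CommGroup G]

/-- The function is constant on the cosets of the subgroup generated by `g`, each of which has
`orderOf g` elements. -/
theorem orderOf_dvd_sum_of_mul_right_eq [Fintype G] (g : G) (s : G → R)
    (hs : ∀ h, s (h * g) = s h) : (orderOf g : R) ∣ ∑ h, s h := by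
  classical
  let H := Subgroup.zpowers g
  have hsH : ∀ k ∈ H, ∀ h, s (h * k) = s h := by
    intro k hk
    obtain ⟨n, rfl⟩ := (isOfFinOrder_of_finite g).mem_powers_iff_mem_zpowers.2 hk
    dsimp only
    induction n with
    | zero => simp
    | succ n ih =>
      intro h
      rw [pow_succ, ← mul_assoc, hs, ih ⟨n, by simp⟩]
  have hb : Function.Bijective fun x : (G ⧸ H) × H => x.1.out * (x.2 : G) := by
    constructor
    · rintro ⟨c, k⟩ ⟨c', k'⟩ h
      dsimp only at h
      have hc : c = c' := by
        have := congrArg (QuotientGroup.mk (s := H)) h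
        rwa [QuotientGroup.mk_mul_of_mem _ k.2, QuotientGroup.mk_mul_of_mem _ k'.2,
          QuotientGroup.out_eq', QuotientGroup.out_eq'] at this
      subst hc
      simpa using h
    · intro h
      have : (QuotientGroup.mk h : G ⧸ H).out⁻¹ * h ∈ H := by
        rw [← QuotientGroup.eq, QuotientGroup.out_eq']
      exact ⟨(QuotientGroup.mk h, ⟨_, this⟩), by simp⟩
  rw [← hb.sum_comp, Fintype.sum_prod_type]
  refine Finset.dvd_sum fun c _ => ?_
  simp only [hsH _ (Subtype.prop _)]
  rw [Finset.sum_const, Finset.card_univ, Fintype.card_zpowers, nsmul_eq_mul]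
  exact Dvd.intro _ rfl

/-- The augmentation map `R[G] → R`. -/
def augmentation (R : Type v) [CommRing R] (G : Type u) [CommGroup G] :
    MonoidAlgebra R G →ₐ[R] R := lift R R G 1

theorem augmentation_apply [Fintype G] (s : MonoidAlgebra R G) :
    augmentation R G s = ∑ g, s.coeff g := by
  rw [augmentation, lift_apply, Finsupp.sum_fintype _ _ (by simp)]
  simp

theorem augmentation_of (g : G) : augmentation R G (of R G g) = 1 := by
  rw [augmentation, lift_of]
  rfl

theorem natCast_mul_monoidAlgebra_eq_zero [IsDomain R] {p : ℕ} (hp : (p : R) ≠ 0)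
    {a : MonoidAlgebra R G} (h : (p : MonoidAlgebra R G) * a = 0) : a = 0 := by
  ext g
  have := congrArg (fun b => b.coeff g) h
  rw [← nsmul_eq_mul] at this
  change p • a.coeff g = 0 at this
  rw [nsmul_eq_mul] at this
  exact (mul_eq_zero.1 this).resolve_left hp

/-- A nonzero prime ideal of a unique factorisation domain contains a prime element; if that element
is divisible by `π` it is associated to `π`. -/
theorem not_lt_of_lt_span_singleton_prime [IsDomain R] [UniqueFactorizationMonoid R] {π : R}
    (hπ : Prime π) {P₀ P₁ : Ideal R} [P₁.IsPrime] (h₀ : P₀ < P₁)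
    (h₁ : P₁ < Ideal.span {π}) : False := by
  obtain ⟨x, hx, hxp⟩ := Ideal.IsPrime.exists_mem_prime_of_ne_bot ‹P₁.IsPrime› (ne_bot_of_gt h₀)
  have hd := Ideal.mem_span_singleton.1 (h₁.le hx)
  have := (hπ.dvd_prime_iff_associated hxp).1 hd
  refine h₁.not_ge ((Ideal.span_singleton_le_iff_mem _).2 ?_)
  obtain ⟨u, hu⟩ := this.symm
  rw [← hu]
  exact P₁.mul_mem_right _ hx

instance [Finite G] : Algebra.IsIntegral R (MonoidAlgebra R G) := by
  have : Module.Finite R (MonoidAlgebra R G) :=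
    Module.Finite.equiv (coeffLinearEquiv R : MonoidAlgebra R G ≃ₗ[R] G →₀ R).symm
  infer_instance

/-- If `p` is a prime element of the unique factorisation domain `R` and divides the order of `G`,
then `R[G]` is not amenable. -/
theorem not_isAmenableRing_monoidAlgebra [IsDomain R] [UniqueFactorizationMonoid R] [Finite G]
    {p : ℕ} [Fact p.Prime] (hp : Prime (p : R)) (hG : p ∣ Nat.card G) :
    ¬ IsAmenableRing (MonoidAlgebra R G) := by
  have := Fintype.ofFinite G
  intro hA
  let A := MonoidAlgebra R G
  let ε := augmentation R G
  have hR : (Ideal.span {(p : R)}).IsPrime := (Ideal.span_singleton_prime hp.ne_zero).2 hp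
  let Q : PrimeSpectrum A := ⟨(Ideal.span {(p : R)}).comap ε, inferInstance⟩
  have hQ : ∀ a : A, a ∈ Q.asIdeal ↔ (p : R) ∣ ε a := fun a => by
    rw [← Ideal.mem_span_singleton]
    rfl
  have hQR : Q.asIdeal.comap (algebraMap R A) = Ideal.span {(p : R)} := by
    ext r
    rw [Ideal.mem_comap, hQ, Ideal.mem_span_singleton]
    have : ε (algebraMap R A r) = r := ε.commutes r
    rw [this]
  have hpA : (p : A) ∈ nonZeroDivisors A :=
    mem_nonZeroDivisors_iff_right.2 fun a h => natCast_mul_monoidAlgebra_eq_zero hp.ne_zero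
      ((mul_comm _ _).trans h)
  have hpQ : (p : A) ∈ Q.asIdeal := by
    rw [hQ, map_natCast]
  have hheight : Q.asIdeal.height = 1 := by
    apply le_antisymm
    -- Contraction to `R` is strictly monotone on primes because `R[G]` is integral over `R`, so a
    -- chain of length two below `Q` would give one below `(p)`.
    · refine Ideal.height_le_iff.2 fun P hP hPQ => ?_
      by_contra hcon
      have h0 : P.height ≠ 0 := fun h => hcon (by rw [h]; exact zero_lt_one)
      rw [Ne, Ideal.height_eq_zero_iff, minimalPrimes_eq_minimals] at h0
      obtain ⟨P₀, hP₀, hlt⟩ : ∃ P₀ : Ideal A, P₀.IsPrime ∧ P₀ < P := by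
        by_contra! h
        refine h0 ⟨hP, fun J hJ hJP => ?_⟩
        by_contra hne
        exact h J hJ (lt_of_le_not_ge hJP hne)
      have h1 := Ideal.IsIntegral.comap_lt_comap (R := R) hlt
      have h2 := Ideal.IsIntegral.comap_lt_comap (R := R) hPQ
      rw [hQR] at h2
      exact not_lt_of_lt_span_singleton_prime hp h1 h2
    · exact (Ideal.one_le_height_span_singleton_of_mem_nonZeroDivisors hpA).trans
        (Ideal.height_mono ((Ideal.span_singleton_le_iff_mem _).2 hpQ))
  let M := A ⧸ Ideal.span {(p : A)}
  have hM0 : ∀ m : M, (p : A) • m = 0 := by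
    intro m
    obtain ⟨a, rfl⟩ := Ideal.Quotient.mk_surjective m
    change Ideal.Quotient.mk _ ((p : A) * a) = 0
    rw [Ideal.Quotient.eq_zero_iff_mem]
    exact Ideal.mul_mem_right _ _ (Ideal.mem_span_singleton_self _)
  have hMt : Module.IsTorsion A M := fun {m} => ⟨⟨p, hpA⟩, hM0 m⟩
  have hMfp : Module.FinitePresentation A M :=
    Module.finitePresentation_of_surjective (Submodule.mkQ (Ideal.span {(p : A)}))
      (Submodule.mkQ_surjective _) (by rw [Submodule.ker_mkQ]; exact ⟨{(p : A)}, by simp⟩)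
  have ham := hA.amenable M hMfp hMt
  have hQM : Q ∈ heightOneTorsionSupport A M := by
    refine ⟨hheight, Module.mem_support_iff_exists_annihilator.2
      ⟨⟨Ideal.Quotient.mk _ 1, ⟨⟨p, hpA⟩, hM0 _⟩⟩, fun a ha => ?_⟩⟩
    rw [Submodule.mem_annihilator_span_singleton] at ha
    have h1 : Ideal.Quotient.mk (Ideal.span {(p : A)}) (a * 1) = 0 := congrArg Subtype.val ha
    rw [mul_one, Ideal.Quotient.eq_zero_iff_mem] at h1
    exact (Ideal.span_singleton_le_iff_mem _).2 hpQ h1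
  have hmax : Maximal (fun P' : PrimeSpectrum A =>
      (P'.asIdeal : Set A) ⊆ ⋃ q ∈ heightOneTorsionSupport A M, (q.asIdeal : Set A)) Q := by
    refine ⟨Set.subset_biUnion_of_mem (u := fun q : PrimeSpectrum A => (q.asIdeal : Set A)) hQM,
      fun P hP hQP => ?_⟩
    -- Amenability of `A/p` itself provides the finiteness needed for prime avoidance; equal heights
    -- then rule out a prime strictly larger than `Q`.
    obtain ⟨q, hq, hPq⟩ := (Ideal.subset_union_prime_finite ham.finite_primes
      (f := fun q : PrimeSpectrum A => q.asIdeal) Q Q fun q _ _ _ => q.isPrime).1 hP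
    by_contra hne
    have hlt : Q.asIdeal < q.asIdeal :=
      (lt_of_le_not_ge hQP hne : Q.asIdeal < P.asIdeal).trans_le hPq
    have := Ideal.height_add_one_le_of_lt_of_isPrime hlt
    rw [hheight, hq.1] at this
    exact absurd this (by decide)
  have htot := (ideal_total_localization_iff Q.asIdeal).1 (ham.valuation Q hmax)
  obtain ⟨g, hg⟩ := exists_prime_orderOf_dvd_card' p hG
  let γ : A := of R G g
  have hγ : γ ^ p = 1 := by
    rw [← map_pow, ← hg, pow_orderOf_eq_one, map_one]
  -- The norm element satisfies `y * (γ - 1) = 0` and `y * y = p * y`. Multiplying either comparison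
  -- of `γ - 1` with `y` by `y` and cancelling `p` forces both of its sides to vanish.
  let y : A := ∑ i ∈ Finset.range p, γ ^ i
  have hyx : y * (γ - 1) = 0 := by
    rw [geom_sum_mul, hγ, sub_self]
  have hyy : y * y = p * y := by
    have h1 : ∀ i, γ ^ i * y = y := by
      intro i
      induction i with
      | zero => simp
      | succ i ih => rw [pow_succ, mul_assoc, ← sub_eq_zero]; linear_combination ih + γ ^ i * hyx
    calc y * y = ∑ i ∈ Finset.range p, γ ^ i * y := Finset.sum_mul _ _ _
      _ = p * y := by simp [h1]
  have hεγ : ε γ = 1 := augmentation_of g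
  have hεy : ε y = p := by simp [y, hεγ]
  obtain ⟨s, hs, c, h | h⟩ := htot (γ - 1) y
  · have h0 : s * (γ - 1) = 0 := by
      have : c * y = 0 := natCast_mul_monoidAlgebra_eq_zero (p := p) hp.ne_zero (by
        linear_combination (-c) * hyy - y * h + s * hyx)
      rw [h, this]
    apply hs
    rw [hQ]
    -- Since `s * γ = s`, the coefficients of `s` are constant on cosets of `⟨g⟩`, so `p` divides
    -- the augmentation of `s`, contradicting `s ∉ Q`.
    have := orderOf_dvd_sum_of_mul_right_eq g⁻¹ s.coeff (fun k => by
      have h1 : s * γ = s := by linear_combination h0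
      have h2 := congrArg (fun b : MonoidAlgebra R G => b.coeff k) h1
      have h3 := coeff_mul_single_apply s (1 : R) g k
      rw [mul_one] at h3
      exact h3.symm.trans h2)
    rw [orderOf_inv, hg] at this
    rwa [augmentation_apply]
  · have h0 : s * y = 0 := natCast_mul_monoidAlgebra_eq_zero (p := p) hp.ne_zero (by
      linear_combination (-s) * hyy + y * h + c * hyx)
    have h1 : ε s * p = 0 := by rw [← hεy, ← map_mul, h0, map_zero]
    apply hs
    rw [hQ, (mul_eq_zero.1 h1).resolve_right hp.ne_zero]
    exact dvd_zero _

end GroupRing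

/-! ### Coefficientwise `p`-adic completeness. -/

section AdicCompleteness

theorem smodEq_span_singleton_pow {B : Type*} [CommRing B] {c : B} {n : ℕ} {x y : B} :
    x ≡ y [SMOD (Ideal.span {c} ^ n • ⊤ : Submodule B B)] ↔ c ^ n ∣ x - y := by
  rw [SModEq.sub_mem, smul_eq_mul, Ideal.mul_top, Ideal.span_singleton_pow,
    Ideal.mem_span_singleton]

/-- Multiplication by `p ^ n` is an integer multiple, so the `p`-adic filtration depends only on the
additive group; an additive isomorphism with a product therefore suffices. -/
theorem isAdicComplete_span_natCast_of_addEquiv {B S ι : Type*} [CommRing B] [CommRing S] (p : ℕ)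
    [IsAdicComplete (Ideal.span {(p : S)}) S] (e : B ≃+ (ι → S)) :
    IsAdicComplete (Ideal.span {(p : B)}) B := by
  have hdvd : ∀ n (x : B), (p : B) ^ n ∣ x ↔ ∀ i, (p : S) ^ n ∣ e x i := by
    intro n x
    have hB : ∀ z : B, (p : B) ^ n * z = (p ^ n) • z := fun z => by simp
    have hS : ∀ z : S, (p : S) ^ n * z = (p ^ n) • z := fun z => by simp
    constructor
    · rintro ⟨z, rfl⟩ i
      exact ⟨e z i, by rw [hB, hS, map_nsmul, Pi.smul_apply]⟩
    · intro h
      choose z hz using h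
      refine ⟨e.symm z, e.injective (funext fun i => ?_)⟩
      rw [hB, map_nsmul, e.apply_symm_apply, Pi.smul_apply, hz, hS]
  refine { haus' := fun x hx => ?_, prec' := fun f hf => ?_ }
  · refine e.injective (funext fun i => ?_)
    rw [map_zero, Pi.zero_apply]
    refine IsHausdorff.haus' (I := Ideal.span {(p : S)}) _ fun n => ?_
    have := smodEq_span_singleton_pow.1 (hx n)
    rw [smodEq_span_singleton_pow, sub_zero]
    rw [sub_zero] at this
    exact (hdvd n x).1 this i
  · have h : ∀ i, ∃ L : S, ∀ n, (p : S) ^ n ∣ e (f n) i - L := by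
      intro i
      obtain ⟨L, hL⟩ := IsPrecomplete.prec' (I := Ideal.span {(p : S)}) (fun n => e (f n) i)
        fun {m n} hmn => by
          rw [smodEq_span_singleton_pow]
          have := (hdvd m _).1 (smodEq_span_singleton_pow.1 (hf hmn)) i
          rwa [map_sub] at this
      exact ⟨L, fun n => smodEq_span_singleton_pow.1 (hL n)⟩
    choose L hL using h
    refine ⟨e.symm L, fun n => ?_⟩
    rw [smodEq_span_singleton_pow, hdvd]
    intro i
    rw [map_sub, e.apply_symm_apply]
    exact hL i n

instance (p : ℕ) [Fact p.Prime] : IsAdicComplete (Ideal.span {(p : ℤ_[p])}) ℤ_[p] := by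
  rw [← PadicInt.maximalIdeal_eq_span_p]
  infer_instance

end AdicCompleteness

/-! ### Extension of ideals from constants to power series. -/

section Coefficients

open MvPowerSeries

variable {σ : Type*} {B : Type*} [CommRing B]

/-- Finite generation matters for the reverse direction: the coefficients are expanded in one fixed
finite set of generators, and the expansion coefficients are collected into one power series per
generator. -/
theorem mem_map_C_iff {P : Ideal B} (hP : P.FG) (f : MvPowerSeries σ B) :
    f ∈ P.map (C (σ := σ)) ↔ ∀ d, coeff d f ∈ P := by
  constructor
  · intro hf
    have hle : P.map (C (σ := σ)) ≤
        RingHom.ker (MvPowerSeries.map (σ := σ) (Ideal.Quotient.mk P)) := by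
      rw [Ideal.map_le_iff_le_comap]
      intro x hx
      rw [Ideal.mem_comap, RingHom.mem_ker, MvPowerSeries.map_C,
        Ideal.Quotient.eq_zero_iff_mem.2 hx, map_zero]
    intro d
    have := congrArg (coeff d) (hle hf)
    rwa [coeff_map, map_zero, Ideal.Quotient.eq_zero_iff_mem] at this
  · classical
    intro hf
    obtain ⟨s, rfl⟩ := hP
    have h : ∀ d, ∃ c : B → B, ∑ a ∈ s, c a * a = coeff d f := fun d =>
      Submodule.mem_span_finset'.1 (hf d) |>.elim fun c hc =>
        ⟨fun a => if h : a ∈ s then c ⟨a, h⟩ else 0, by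
          rw [← hc, ← Finset.sum_coe_sort]
          simp⟩
    choose c hc using h
    have : f = ∑ a ∈ s, (show MvPowerSeries σ B from fun d => c d a) * C a := by
      ext d
      rw [map_sum, ← hc d]
      refine Finset.sum_congr rfl fun a _ => ?_
      rw [coeff_mul_C]
      rfl
    rw [this]
    exact sum_mem fun a ha => Ideal.mul_mem_left _ _
      (Ideal.mem_map_of_mem _ (Ideal.subset_span ha))

/-- The extended ideal is the kernel of reduction to power series over the domain `B ⧸ P`. -/
theorem isPrime_map_C {P : Ideal B} (hP : P.FG) [P.IsPrime] :
    (P.map (C (σ := σ) (R := B))).IsPrime := by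
  have : P.map (C (σ := σ)) = RingHom.ker (MvPowerSeries.map (σ := σ) (Ideal.Quotient.mk P)) := by
    ext f
    rw [mem_map_C_iff hP, RingHom.mem_ker, MvPowerSeries.ext_iff]
    refine forall_congr' fun d => ?_
    rw [coeff_map, map_zero, Ideal.Quotient.eq_zero_iff_mem]
  have : IsDomain (MvPowerSeries σ (B ⧸ P)) := NoZeroDivisors.to_isDomain _
  rw [‹P.map (C (σ := σ)) = _›]
  exact RingHom.ker_isPrime _

theorem prime_C {π : B} [IsDomain B] (hπ : Prime π) : Prime (C (σ := σ) π) := by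
  have h0 : C (σ := σ) π ≠ 0 := fun h => hπ.ne_zero (by
    have := congrArg (constantCoeff (σ := σ)) h
    rwa [constantCoeff_C, map_zero] at this)
  rw [← Ideal.span_singleton_prime h0, ← Set.image_singleton, ← Ideal.map_span]
  have := (Ideal.span_singleton_prime hπ.ne_zero).2 hπ
  exact isPrime_map_C ⟨{π}, by simp⟩

end Coefficients

/-! ### Splitting the variables into the first `n` and the rest. -/

section NestedPowerSeries

open MvPowerSeries

variable {ρ σ τ S : Type*} [CommRing S]

/-- Power series in the variables `ρ`, whose exponents split as pairs of exponents in `σ` and `τ`,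
regarded as power series in the variables `τ` over the power series in the variables `σ`. -/
def nest (E : (ρ →₀ ℕ) ≃+ (σ →₀ ℕ) × (τ →₀ ℕ)) (f : MvPowerSeries ρ S) :
    MvPowerSeries τ (MvPowerSeries σ S) :=
  fun y => (show MvPowerSeries σ S from fun x => coeff (E.symm (x, y)) f)

theorem coeff_coeff_nest (E : (ρ →₀ ℕ) ≃+ (σ →₀ ℕ) × (τ →₀ ℕ)) (f : MvPowerSeries ρ S)
    (x : σ →₀ ℕ) (y : τ →₀ ℕ) :
    coeff x (coeff y (nest E f)) = coeff (E.symm (x, y)) f := rfl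

/-- As `E` is additive, it matches decompositions of an exponent with pairs of decompositions of its
two components. -/
theorem nest_mul (E : (ρ →₀ ℕ) ≃+ (σ →₀ ℕ) × (τ →₀ ℕ)) (f g : MvPowerSeries ρ S) :
    nest E (f * g) = nest E f * nest E g := by
  classical
  refine MvPowerSeries.ext fun y => MvPowerSeries.ext fun x => ?_
  rw [coeff_coeff_nest]
  simp only [coeff_mul, map_sum, coeff_coeff_nest]
  rw [← Finset.sum_product']
  refine Finset.sum_nbij' (fun a => (((E a.1).2, (E a.2).2), ((E a.1).1, (E a.2).1)))
    (fun b => (E.symm (b.2.1, b.1.1), E.symm (b.2.2, b.1.2))) ?_ ?_ ?_ ?_ ?_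
  · rintro ⟨a, b⟩ h
    have h1 : E a + E b = (x, y) := by
      rw [← map_add, Finset.HasAntidiagonal.mem_antidiagonal.1 h, E.apply_symm_apply]
    simp [← Prod.fst_add, ← Prod.snd_add, h1]
  · rintro ⟨⟨a, b⟩, ⟨c, d⟩⟩ h
    simp only [Finset.mem_product, Finset.HasAntidiagonal.mem_antidiagonal] at h
    simp [← map_add, h.1, h.2]
  · rintro ⟨a, b⟩ h
    simp
  · rintro ⟨⟨a, b⟩, ⟨c, d⟩⟩ h
    simp
  · rintro ⟨a, b⟩ h
    simp

/-- `nest` as a ring isomorphism. -/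
def nestedEquiv (E : (ρ →₀ ℕ) ≃+ (σ →₀ ℕ) × (τ →₀ ℕ)) :
    MvPowerSeries ρ S ≃+* MvPowerSeries τ (MvPowerSeries σ S) where
  toFun := nest E
  invFun f := fun d => coeff (E d).1 (coeff (E d).2 f)
  left_inv f := by
    refine MvPowerSeries.ext fun d => ?_
    change coeff (E d).1 (coeff (E d).2 (nest E f)) = _
    rw [coeff_coeff_nest]
    simp
  right_inv f := by
    refine MvPowerSeries.ext fun y => MvPowerSeries.ext fun x => ?_
    change coeff (E (E.symm (x, y))).1 (coeff (E (E.symm (x, y))).2 f) = _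
    simp
  map_add' f g := rfl
  map_mul' := nest_mul E

theorem coeff_coeff_nestedEquiv (E : (ρ →₀ ℕ) ≃+ (σ →₀ ℕ) × (τ →₀ ℕ)) (f : MvPowerSeries ρ S)
    (x : σ →₀ ℕ) (y : τ →₀ ℕ) :
    coeff x (coeff y (nestedEquiv E f)) = coeff (E.symm (x, y)) f := rfl

/-- Exponents in countably many variables, split into the exponents of the first `n` variables
and the exponents of the others. -/
def splitExponents (n : ℕ) : (ℕ →₀ ℕ) ≃+ (Fin n →₀ ℕ) × (ℕ →₀ ℕ) :=
  (Finsupp.domCongr (finSumNatEquiv n).symm).trans Finsupp.sumFinsuppAddEquivProdFinsupp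

theorem splitExponents_symm_apply_fin (n : ℕ) (x : Fin n →₀ ℕ) (y : ℕ →₀ ℕ) (i : Fin n) :
    (splitExponents n).symm (x, y) i = x i := by
  have : (i : ℕ) = finSumNatEquiv n (.inl i) := rfl
  rw [this]
  simp [splitExponents]

theorem splitExponents_symm_apply_add (n : ℕ) (x : Fin n →₀ ℕ) (y : ℕ →₀ ℕ) (i : ℕ) :
    (splitExponents n).symm (x, y) (n + i) = y i := by
  have : n + i = finSumNatEquiv n (.inr i) := rfl
  rw [this]
  simp [splitExponents]

theorem nestedEquiv_rename (n : ℕ) (f : MvPowerSeries (Fin n) S) :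
    nestedEquiv (splitExponents n) (rename (Fin.valEmbedding : Fin n ↪ ℕ) f) = C f := by
  classical
  ext y x
  rw [coeff_coeff_nestedEquiv, coeff_C]
  split_ifs with hy
  · subst hy
    rw [← coeff_embDomain_rename Fin.valEmbedding]
    congr 2
    ext i
    by_cases hi : i < n
    · rw [show i = (⟨i, hi⟩ : Fin n) from rfl, splitExponents_symm_apply_fin]
      exact (Finsupp.embDomain_apply_self _ _ _).symm
    · obtain ⟨k, rfl⟩ := Nat.exists_eq_add_of_le (not_lt.1 hi)
      rw [splitExponents_symm_apply_add, Finsupp.embDomain_of_notMem_range]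
      · rfl
      · rintro ⟨j, hj⟩
        exact hi (hj ▸ j.2)
  · rw [map_zero]
    refine coeff_rename_eq_zero _ _ ?_
    rintro ⟨z, hz⟩
    refine hy (Finsupp.ext fun i => ?_)
    rw [← splitExponents_symm_apply_add n x y i, ← hz, Finsupp.mapDomain_of_notMem_range]
    · rfl
    · rintro ⟨j, hj⟩
      have hj' : (j : ℕ) = n + i := hj
      omega

end NestedPowerSeries

/-! ### Group rings of power series rings as power series over group rings. -/

section GroupRing

open MonoidAlgebra

variable {S : Type*} [CommRing S] {τ : Type*} {G : Type*} [CommGroup G]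

/-- The map from the group ring of a power series ring to the power series ring over the group
ring. -/
def groupRingHom (τ S G : Type*) [CommRing S] [CommGroup G] :
    MonoidAlgebra (MvPowerSeries τ S) G →+* MvPowerSeries τ (MonoidAlgebra S G) :=
  liftNCRingHom (MvPowerSeries.map singleOneRingHom)
    ((MvPowerSeries.C (σ := τ) : _ →+* _).toMonoidHom.comp (of S G)) fun _ _ => Commute.all _ _

theorem coeff_coeff_groupRingHom (a : MonoidAlgebra (MvPowerSeries τ S) G) (d : τ →₀ ℕ) (g : G) :
    (MvPowerSeries.coeff d (groupRingHom τ S G a)).coeff g = MvPowerSeries.coeff d (a.coeff g) := by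
  classical
  induction a using MonoidAlgebra.induction_linear with
  | zero => simp
  | add x y hx hy => simp [hx, hy]
  | single m r =>
    rw [groupRingHom, liftNCRingHom_single]
    have : ((MvPowerSeries.C (σ := τ) : _ →+* _).toMonoidHom.comp (of S G)) m =
      MvPowerSeries.C (σ := τ) (of S G m) := rfl
    rw [this, MvPowerSeries.coeff_mul_C, MvPowerSeries.coeff_map, of_apply]
    change ((single 1 (MvPowerSeries.coeff d r) : MonoidAlgebra S G) * single m 1).coeff g = _
    rw [single_mul_single, coeff_single, coeff_single, Finsupp.single_apply, Finsupp.single_apply]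
    split_ifs <;> simp_all

/-- For a finite group, the group ring of a power series ring is the power series ring over the
group ring. -/
def groupRingEquiv (τ S G : Type*) [CommRing S] [CommGroup G] [Finite G] :
    MonoidAlgebra (MvPowerSeries τ S) G ≃+* MvPowerSeries τ (MonoidAlgebra S G) :=
  RingEquiv.ofBijective (groupRingHom τ S G) <| by
    constructor
    · intro a b h
      ext g d
      rw [← coeff_coeff_groupRingHom, h, coeff_coeff_groupRingHom]
    · intro f
      refine ⟨ofCoeff (Finsupp.equivFunOnFinite.symm fun g => fun d =>
        (MvPowerSeries.coeff d f).coeff g), ?_⟩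
      ext d g
      rw [coeff_coeff_groupRingHom]
      rfl

theorem coeff_coeff_groupRingEquiv [Finite G] (a : MonoidAlgebra (MvPowerSeries τ S) G)
    (d : τ →₀ ℕ) (g : G) :
    (MvPowerSeries.coeff d (groupRingEquiv τ S G a)).coeff g = MvPowerSeries.coeff d (a.coeff g) :=
  coeff_coeff_groupRingHom a d g

end GroupRing

/-! ### Primes of `A_n` extend to primes of `A`. -/

section Extension

variable (p : ℕ) [Fact p.Prime] (G : Type u) [CommGroup G] [Finite G]

instance isNoetherianRing_Afin (n : ℕ) : IsNoetherianRing (Afin p G n) := by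
  have : Module.Finite (Rfin p n) (Afin p G n) :=
    Module.Finite.equiv (MonoidAlgebra.coeffLinearEquiv (Rfin p n) :
      Afin p G n ≃ₗ[Rfin p n] G →₀ Rfin p n).symm
  exact IsNoetherianRing.of_finite (Rfin p n) (Afin p G n)

/-- `A` as a power series ring over `A_n`. -/
def AinfEquiv (n : ℕ) : Ainf p G ≃+* MvPowerSeries ℕ (Afin p G n) :=
  (MonoidAlgebra.mapRingEquiv G (nestedEquiv (splitExponents n))).trans
    (groupRingEquiv ℕ (Rfin p n) G)

theorem AinfEquiv_inclA (n : ℕ) (a : Afin p G n) :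
    AinfEquiv p G n (inclA p G n a) = MvPowerSeries.C a := by
  classical
  refine MvPowerSeries.ext fun d => MonoidAlgebra.ext (Finsupp.ext fun g => ?_)
  rw [AinfEquiv, RingEquiv.trans_apply, coeff_coeff_groupRingEquiv,
    MonoidAlgebra.coeff_mapRingEquiv, inclA, MonoidAlgebra.coeff_mapRingHom]
  have : inclR p n (a.coeff g) = MvPowerSeries.rename (Fin.valEmbedding : Fin n ↪ ℕ) (a.coeff g) :=
    rfl
  rw [this, nestedEquiv_rename, MvPowerSeries.coeff_C, MvPowerSeries.coeff_C]
  split_ifs <;> rfl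

/-- Under `AinfEquiv` the map `ι_n` is the inclusion of constants, and `P` is finitely generated
because `A_n` is noetherian. -/
theorem isPrime_map_inclA (n : ℕ) (P : Ideal (Afin p G n)) [P.IsPrime] :
    (P.map (inclA p G n)).IsPrime := by
  have h : (P.map (inclA p G n)).map (AinfEquiv p G n : Ainf p G →+* _) =
      P.map (MvPowerSeries.C (σ := ℕ)) := by
    rw [Ideal.map_map]
    congr 1
    exact RingHom.ext fun a => AinfEquiv_inclA p G n a
  have hP : (P.map (MvPowerSeries.C (σ := ℕ))).IsPrime := isPrime_map_C (IsNoetherian.noetherian P)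
  have h2 : P.map (inclA p G n) = (P.map (MvPowerSeries.C (σ := ℕ))).comap (AinfEquiv p G n) := by
    rw [← h]
    exact (Ideal.comap_map_of_bijective _ (AinfEquiv p G n).bijective).symm
  rw [h2]
  exact Ideal.comap_isPrime _ _

end Extension

/-! ### Completeness of power series rings at the maximal ideal. -/

section LocalCompleteness

open IsLocalRing

theorem smodEq_ideal_pow {B : Type*} [CommRing B] {I : Ideal B} {n : ℕ} {x y : B} :
    x ≡ y [SMOD (I ^ n • ⊤ : Submodule B B)] ↔ x - y ∈ I ^ n := by
  rw [SModEq.sub_mem, smul_eq_mul, Ideal.mul_top]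

theorem isAdicComplete_maximalIdeal_of_ringEquiv {A B : Type*} [CommRing A] [CommRing B]
    [IsLocalRing A] [IsLocalRing B] (e : A ≃+* B) [IsAdicComplete (maximalIdeal A) A] :
    IsAdicComplete (maximalIdeal B) B := by
  have hm : maximalIdeal B = (maximalIdeal A).map (e : A →+* B) := by
    have := Ideal.map_isMaximal_of_equiv e (p := maximalIdeal A)
    exact (eq_maximalIdeal this).symm
  have hmem : ∀ n (x : A), e x ∈ maximalIdeal B ^ n ↔ x ∈ maximalIdeal A ^ n := by
    intro n x
    rw [hm, ← Ideal.map_pow, Ideal.mem_map_iff_of_surjective (e : A →+* B) e.surjective]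
    exact ⟨fun ⟨y, hy, h⟩ => e.injective h ▸ hy, fun h => ⟨x, h, rfl⟩⟩
  refine { haus' := fun x hx => ?_, prec' := fun f hf => ?_ }
  · obtain ⟨x, rfl⟩ := e.surjective x
    rw [IsHausdorff.haus' (I := maximalIdeal A) x fun n => ?_, map_zero]
    have := smodEq_ideal_pow.1 (hx n)
    rw [sub_zero, hmem] at this
    rwa [smodEq_ideal_pow, sub_zero]
  · obtain ⟨L, hL⟩ := IsPrecomplete.prec' (I := maximalIdeal A) (fun n => e.symm (f n))
      fun {m n} hmn => by
        have := smodEq_ideal_pow.1 (hf hmn)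
        rwa [smodEq_ideal_pow, ← hmem, map_sub, e.apply_symm_apply, e.apply_symm_apply]
    refine ⟨e L, fun n => ?_⟩
    have := smodEq_ideal_pow.1 (hL n)
    rwa [← hmem, map_sub, e.apply_symm_apply, ← smodEq_ideal_pow] at this

variable {A : Type*} [CommRing A] [IsLocalRing A]

theorem mem_maximalIdeal_powerSeries {f : PowerSeries A} :
    f ∈ maximalIdeal (PowerSeries A) ↔ PowerSeries.constantCoeff f ∈ maximalIdeal A := by
  rw [mem_maximalIdeal, mem_maximalIdeal, mem_nonunits_iff, mem_nonunits_iff,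
    PowerSeries.isUnit_iff_constantCoeff]

/-- The maximal ideal is generated by that of `A` and by `X`, so each factor `X` saves one power of
the former. -/
theorem mem_maximalIdeal_powerSeries_pow {n : ℕ} {f : PowerSeries A} :
    f ∈ maximalIdeal (PowerSeries A) ^ n ↔
      ∀ i, PowerSeries.coeff i f ∈ maximalIdeal A ^ (n - i) := by
  constructor
  · intro hf
    induction n generalizing f with
    | zero => simp
    | succ n ih =>
      rw [pow_succ] at hf
      refine Submodule.mul_induction_on hf (fun g hg h hh i => ?_) fun x y hx hy i => ?_
      · rw [PowerSeries.coeff_mul]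
        refine sum_mem fun ab hab => ?_
        have hab : ab.1 + ab.2 = i := Finset.HasAntidiagonal.mem_antidiagonal.1 hab
        by_cases h0 : ab.2 = 0
        · have h1 : PowerSeries.coeff ab.2 h ∈ maximalIdeal A := by
            rw [h0, PowerSeries.coeff_zero_eq_constantCoeff_apply]
            exact mem_maximalIdeal_powerSeries.1 hh
          have h2 := Ideal.mul_mem_mul (ih hg ab.1) h1
          rw [← pow_succ] at h2
          exact Ideal.pow_le_pow_right (by omega) h2
        · exact Ideal.pow_le_pow_right (by omega) (Ideal.mul_mem_right _ _ (ih hg ab.1))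
      · rw [map_add]
        exact add_mem (hx i) (hy i)
  · intro hf
    induction n generalizing f with
    | zero => simp
    | succ n ih =>
      rw [PowerSeries.eq_X_mul_shift_add_const f]
      refine add_mem ?_ ?_
      · rw [pow_succ']
        refine Ideal.mul_mem_mul (mem_maximalIdeal_powerSeries.2 (by simp)) (ih fun i => ?_)
        rw [PowerSeries.coeff_mk]
        have := hf (i + 1)
        rwa [Nat.add_sub_add_right] at this
      · have h0 := hf 0
        rw [PowerSeries.coeff_zero_eq_constantCoeff_apply, Nat.sub_zero] at h0
        have hle : (maximalIdeal A).map (PowerSeries.C (R := A)) ≤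
            maximalIdeal (PowerSeries A) := by
          rw [Ideal.map_le_iff_le_comap]
          intro a ha
          rw [Ideal.mem_comap, mem_maximalIdeal_powerSeries]
          simpa using ha
        refine Ideal.pow_right_mono hle _ ?_
        rw [← Ideal.map_pow]
        exact Ideal.mem_map_of_mem _ h0

instance isAdicComplete_powerSeries [IsAdicComplete (maximalIdeal A) A] :
    IsAdicComplete (maximalIdeal (PowerSeries A)) (PowerSeries A) := by
  refine { haus' := fun f hf => ?_, prec' := fun f hf => ?_ }
  · ext i
    rw [map_zero]
    refine IsHausdorff.haus' (I := maximalIdeal A) _ fun n => ?_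
    have := smodEq_ideal_pow.1 (hf (n + i))
    rw [sub_zero, mem_maximalIdeal_powerSeries_pow] at this
    have := this i
    rwa [smodEq_ideal_pow, sub_zero, ← Nat.add_sub_cancel n i]
  · have key : ∀ m n, m ≤ n → ∀ i, PowerSeries.coeff i (f m) - PowerSeries.coeff i (f n) ∈
        maximalIdeal A ^ (m - i) := by
      intro m n hmn i
      have := mem_maximalIdeal_powerSeries_pow.1 (smodEq_ideal_pow.1 (hf hmn)) i
      rwa [map_sub] at this
    -- The `i`-th coefficient of an element of the `m`-th power is controlled only to order `m - i`,
    -- hence the delay by `i`.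
    have : ∀ i, ∃ L : A, ∀ n, PowerSeries.coeff i (f (n + i)) - L ∈ maximalIdeal A ^ n := by
      intro i
      obtain ⟨L, hL⟩ := IsPrecomplete.prec' (I := maximalIdeal A)
        (fun n => PowerSeries.coeff i (f (n + i))) fun {m n} hmn => by
          rw [smodEq_ideal_pow]
          have := key (m + i) (n + i) (by omega) i
          rwa [Nat.add_sub_cancel] at this
      exact ⟨L, fun n => smodEq_ideal_pow.1 (hL n)⟩
    choose L hL using this
    refine ⟨PowerSeries.mk L, fun n => ?_⟩
    rw [smodEq_ideal_pow, mem_maximalIdeal_powerSeries_pow]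
    intro i
    rw [map_sub, PowerSeries.coeff_mk]
    -- The index `n - i + i` is `max n i`; for `n < i` the exponent `n - i` is `0` and nothing is
    -- claimed.
    have h1 := key n (n - i + i) (by omega) i
    have h2 := add_mem h1 (hL i (n - i))
    rwa [sub_add_sub_cancel] at h2

instance isAdicComplete_mvPowerSeries_fin [IsAdicComplete (maximalIdeal A) A] (n : ℕ) :
    IsAdicComplete (maximalIdeal (MvPowerSeries (Fin n) A)) (MvPowerSeries (Fin n) A) := by
  induction n with
  | zero =>
    exact isAdicComplete_maximalIdeal_of_ringEquiv
      (MvPowerSeries.isEmptyEquiv (Fin 0) A).toRingEquiv.symm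
  | succ n ih =>
    exact isAdicComplete_maximalIdeal_of_ringEquiv (MvPowerSeries.finSuccEquiv A n).toRingEquiv.symm

end LocalCompleteness

/-! ### Factorisation into primes, one element at a time. -/

section PrimeFactorization

/-- `a` is a product of prime elements, up to a unit. -/
def HasPrimeFactors {A : Type*} [CommRing A] (a : A) : Prop :=
  ∃ s : Multiset A, (∀ b ∈ s, Prime b) ∧ Associated s.prod a

theorem HasPrimeFactors.mul {A : Type*} [CommRing A] {a b : A} (ha : HasPrimeFactors a)
    (hb : HasPrimeFactors b) : HasPrimeFactors (a * b) := by
  obtain ⟨s, hs, hsa⟩ := ha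
  obtain ⟨t, ht, htb⟩ := hb
  refine ⟨s + t, fun x hx => (Multiset.mem_add.1 hx).elim (hs x) (ht x), ?_⟩
  rw [Multiset.prod_add]
  exact hsa.mul_mul htb

theorem HasPrimeFactors.of_associated {A : Type*} [CommRing A] {a b : A}
    (ha : HasPrimeFactors a) (h : Associated a b) : HasPrimeFactors b := by
  obtain ⟨s, hs, hsa⟩ := ha
  exact ⟨s, hs, hsa.trans h⟩

theorem hasPrimeFactors_map_of_prime {A B F : Type*} [CommRing A] [CommRing B] [FunLike F A B]
    [MonoidHomClass F A B] (e : F) {a : A} {s : Multiset A} (hs : Associated s.prod a)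
    (h : ∀ b ∈ s, Prime (e b)) : HasPrimeFactors (e a) := by
  refine ⟨s.map e, fun b hb => ?_, ?_⟩
  · obtain ⟨c, hc, rfl⟩ := Multiset.mem_map.1 hb
    exact h c hc
  · rw [Multiset.prod_hom]
    exact hs.map e

theorem HasPrimeFactors.of_ringEquiv {A B : Type*} [CommRing A] [CommRing B]
    (e : A ≃+* B) {a : A} (h : HasPrimeFactors (e a)) : HasPrimeFactors a := by
  obtain ⟨s, hs, hsa⟩ := h
  have := hasPrimeFactors_map_of_prime e.symm hsa fun b hb =>
    (MulEquiv.prime_iff e.symm).2 (hs b hb)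
  rwa [e.symm_apply_apply] at this

theorem ufd_of_hasPrimeFactors {A : Type*} [CommRing A] [IsDomain A]
    (h : ∀ a : A, a ≠ 0 → HasPrimeFactors a) : UniqueFactorizationMonoid A :=
  UniqueFactorizationMonoid.of_exists_prime_factors h

theorem hasPrimeFactors_of_ufd {A : Type*} [CommRing A] [IsDomain A]
    [UniqueFactorizationMonoid A] {a : A} (ha : a ≠ 0) : HasPrimeFactors a :=
  UniqueFactorizationMonoid.exists_prime_factors a ha

end PrimeFactorization

/-! ### Weierstrass preparation and factorisation of regular series. -/

section Weierstrass

open IsLocalRing Polynomial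

variable {A : Type*} [CommRing A] [IsLocalRing A]

/-- Modulo the maximal ideal `P` becomes a power of `X`, whose monic divisors are powers of `X`. -/
theorem isDistinguishedAt_of_dvd {P q : A[X]} (hP : P.IsDistinguishedAt (maximalIdeal A))
    (hq : q.Monic) (h : q ∣ P) : q.IsDistinguishedAt (maximalIdeal A) := by
  let φ := Ideal.Quotient.mk (maximalIdeal A)
  let _ : Field (A ⧸ maximalIdeal A) := Ideal.Quotient.field _
  have h1 : q.map φ ∣ X ^ P.natDegree := by
    rw [← hP.map_eq_X_pow]
    exact Polynomial.map_dvd φ h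
  obtain ⟨k, -, hk⟩ := (dvd_prime_pow prime_X _).1 h1
  have h2 : q.map φ = X ^ k :=
    eq_of_monic_of_associated (hq.map φ) (monic_X_pow k) hk
  have h3 : q.natDegree = k := by
    rw [← hq.natDegree_map φ, h2, natDegree_X_pow]
  refine ⟨⟨fun {i} hi => ?_⟩, hq⟩
  rw [← Ideal.Quotient.eq_zero_iff_mem]
  have := congrArg (fun f => Polynomial.coeff f i) h2
  simp only [coeff_map, coeff_X_pow] at this
  rwa [if_neg (by omega)] at this

/-- By Weierstrass division, `A[X]` and `A[[X]]` have the same quotient by `q`. -/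
theorem prime_coe_of_isDistinguishedAt [IsAdicComplete (maximalIdeal A) A] {q : A[X]}
    (hq : Prime q) (hd : q.IsDistinguishedAt (maximalIdeal A)) : Prime (q : PowerSeries A) := by
  have h0 : (q : PowerSeries A) ≠ 0 := fun h => hq.ne_zero (Polynomial.coe_eq_zero_iff.1 h)
  rw [← Ideal.span_singleton_prime h0, ← Ideal.Quotient.isDomain_iff_prime]
  have : (Ideal.span {q}).IsPrime := (Ideal.span_singleton_prime hq.ne_zero).2 hq
  exact hd.algEquivQuotient.symm.toMulEquiv.isDomain

/-- Up to a unit `g` is a distinguished polynomial; its prime factors in `A[X]`, made monic, are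
again distinguished and so stay prime as power series. -/
theorem hasPrimeFactors_of_map_residue_ne_zero [IsDomain A] [UniqueFactorizationMonoid A]
    [IsAdicComplete (maximalIdeal A) A] {g : PowerSeries A}
    (hg : g.map (residue A) ≠ 0) : HasPrimeFactors g := by
  obtain ⟨P, h, H⟩ := PowerSeries.exists_isWeierstrassFactorization hg
  have hP := H.isDistinguishedAt
  obtain ⟨s, hs, hsP⟩ := hasPrimeFactors_of_ufd hP.monic.ne_zero
  have hPg : Associated (P : PowerSeries A) g := by
    rw [H.eq_mul]
    exact associated_mul_unit_right _ _ H.isUnit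
  refine HasPrimeFactors.of_associated ?_ hPg
  refine hasPrimeFactors_map_of_prime (Polynomial.coeToPowerSeries.ringHom (R := A)) hsP
    fun q hq => ?_
  have hqP : q ∣ P := (Multiset.dvd_prod hq).trans hsP.dvd
  obtain ⟨r, hr⟩ := hqP
  -- The leading coefficient of a factor of a monic polynomial is a unit, so the factor can be
  -- normalised.
  have hlc : IsUnit q.leadingCoeff := by
    refine IsUnit.of_mul_eq_one r.leadingCoeff ?_
    rw [← leadingCoeff_mul, ← hr, hP.monic]
  obtain ⟨u, hu⟩ := hlc
  have hqu : Associated q (q * C (↑u⁻¹ : A)) :=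
    associated_mul_unit_right _ _ ((Units.isUnit u⁻¹).map C)
  have hmon : (q * C (↑u⁻¹ : A)).Monic := by
    rw [Monic, leadingCoeff_mul, leadingCoeff_C, ← hu, Units.mul_inv]
  have hdist := isDistinguishedAt_of_dvd hP hmon (hqu.symm.dvd.trans ⟨r, hr⟩)
  have := prime_coe_of_isDistinguishedAt (hqu.prime (hs q hq)) hdist
  exact (hqu.map (Polynomial.coeToPowerSeries.ringHom (R := A))).symm.prime this

end Weierstrass

/-! ### A shear making a power series regular in the first variable. -/

section ChangeOfVariables

open MvPowerSeries

/-- Among finitely many exponents, weights `D ^ i` with `D` large single out one element of any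
nonempty set of exponents. -/
theorem exists_unique_minimal_weight (m : ℕ) (T : Set (Fin m → ℕ)) (hT : T.Nonempty) :
    ∃ d ∈ T, ∃ D₀, ∀ D ≥ D₀, ∑ i, d i * D ^ (i : ℕ) < D ^ m ∧
      ∀ e ∈ T, ∑ i, e i * D ^ (i : ℕ) ≤ ∑ i, d i * D ^ (i : ℕ) → e = d := by
  induction m with
  | zero =>
    obtain ⟨d, hd⟩ := hT
    exact ⟨d, hd, 0, fun D _ => ⟨by simp, fun e _ _ => Subsingleton.elim _ _⟩⟩
  | succ m ih =>
    classical
    -- The last coordinate carries the largest weight, so it is minimised first and the induction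
    -- treats the others.
    have hc : ∃ c, ∃ e ∈ T, e (Fin.last m) = c := by
      obtain ⟨d, hd⟩ := hT
      exact ⟨_, d, hd, rfl⟩
    let c := Nat.find hc
    have hcmin : ∀ e ∈ T, c ≤ e (Fin.last m) := fun e he => Nat.find_min' hc ⟨e, he, rfl⟩
    obtain ⟨d', hd', D₀, h⟩ := ih {e' | (Fin.snoc e' c : Fin (m + 1) → ℕ) ∈ T} (by
      obtain ⟨e, he, hec⟩ := Nat.find_spec hc
      refine ⟨Fin.init e, ?_⟩
      change (Fin.snoc (Fin.init e) c : Fin (m + 1) → ℕ) ∈ T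
      have : c = e (Fin.last m) := hec.symm
      rwa [this, Fin.snoc_init_self])
    have hsum : ∀ (e' : Fin m → ℕ) (k D : ℕ),
        ∑ i, (Fin.snoc e' k : Fin (m + 1) → ℕ) i * D ^ (i : ℕ) =
          ∑ i, e' i * D ^ (i : ℕ) + k * D ^ m := by
      intro e' k D
      rw [Fin.sum_univ_castSucc]
      simp
    -- With `D > c` the weight of the chosen element is below `D ^ (m + 1)`. A larger last
    -- coordinate contributes at least `(c + 1) * D ^ m`, already too much.
    refine ⟨Fin.snoc d' c, hd', max D₀ (c + 1), fun D hD => ?_⟩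
    obtain ⟨h1, h2⟩ := h D (le_of_max_le_left hD)
    have hDc : c + 1 ≤ D := le_of_max_le_right hD
    constructor
    · rw [hsum, pow_succ']
      calc _ < D ^ m + c * D ^ m := by omega
        _ = (c + 1) * D ^ m := by ring
        _ ≤ D * D ^ m := Nat.mul_le_mul_right _ hDc
    · intro e he hle
      rw [← Fin.snoc_init_self e] at he hle ⊢
      rw [hsum, hsum] at hle
      have hce : c ≤ e (Fin.last m) := by simpa using hcmin _ he
      rcases hce.eq_or_lt with heq | hlt
      · rw [← heq] at he hle ⊢
        rw [h2 _ he (by omega)]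
      · exfalso
        have : (c + 1) * D ^ m ≤ e (Fin.last m) * D ^ m := Nat.mul_le_mul_right _ hlt
        rw [add_mul, one_mul] at this
        omega

variable {O : Type*} [CommRing O] {n : ℕ}

/-- The substitution `X_0 ↦ X_0`, `X_i ↦ X_i + c X_0 ^ (D ^ i)` for `i > 0`. -/
def shear (O : Type*) [CommRing O] (n D : ℕ) (c : O) :
    Fin (n + 1) → MvPowerSeries (Fin (n + 1)) O :=
  Fin.cases (X 0) fun i => X i.succ + C c * X 0 ^ (D ^ ((i : ℕ) + 1))

theorem hasSubst_shear {D : ℕ} (hD : 0 < D) (c : O) : HasSubst (shear O n D c) := by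
  refine hasSubst_of_constantCoeff_zero fun i => ?_
  refine Fin.cases ?_ (fun i => ?_) i
  · simp [shear]
  · have : D ≠ 0 := hD.ne'
    simp [shear, this]

theorem subst_shear_shear {D : ℕ} (hD : 0 < D) {c c' : O} (h : c + c' = 0)
    (f : MvPowerSeries (Fin (n + 1)) O) :
    subst (shear O n D c') (subst (shear O n D c) f) = f := by
  have hc := hasSubst_shear (n := n) hD c
  have hc' := hasSubst_shear (n := n) hD c'
  rw [subst_comp_subst_apply hc hc']
  have : (fun s => subst (shear O n D c') (shear O n D c s)) = X := by
    funext s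
    refine Fin.cases ?_ (fun i => ?_) s
    · change subst (shear O n D c') (X 0) = _
      rw [subst_X hc']
      rfl
    · change subst (shear O n D c') (X i.succ + C c * X 0 ^ (D ^ ((i : ℕ) + 1))) = _
      rw [subst_add hc', subst_mul hc', subst_pow hc', subst_X hc', subst_X hc', subst_C]
      change X i.succ + C c' * X 0 ^ (D ^ ((i : ℕ) + 1)) + C c * X 0 ^ (D ^ ((i : ℕ) + 1)) = _
      have h0 : (C c : MvPowerSeries (Fin (n + 1)) O) + C c' = 0 := by rw [← map_add, h, map_zero]
      linear_combination (X 0 ^ (D ^ ((i : ℕ) + 1))) * h0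
  rw [this, subst_self, id]

/-- The automorphism `X_0 ↦ X_0`, `X_i ↦ X_i + X_0 ^ (D ^ i)` for `i > 0`. -/
def shearEquiv (O : Type*) [CommRing O] (n : ℕ) {D : ℕ} (hD : 0 < D) :
    MvPowerSeries (Fin (n + 1)) O ≃+* MvPowerSeries (Fin (n + 1)) O where
  toFun := subst (shear O n D 1)
  invFun := subst (shear O n D (-1))
  left_inv f := subst_shear_shear hD (add_neg_cancel 1) f
  right_inv f := subst_shear_shear hD (neg_add_cancel 1) f
  map_mul' := subst_mul (hasSubst_shear hD 1)
  map_add' := subst_add (hasSubst_shear hD 1)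

/-- Setting all variables but `X_0` to zero. -/
def restrictZero (O : Type*) [CommRing O] (n : ℕ) :
    MvPowerSeries (Fin (n + 1)) O →+* PowerSeries O :=
  (PowerSeries.map (constantCoeff (σ := Fin n) (R := O))).comp
    (finSuccEquiv O n).toRingEquiv.toRingHom

theorem restrictZero_apply (f : MvPowerSeries (Fin (n + 1)) O) :
    restrictZero O n f = PowerSeries.map constantCoeff (finSuccEquiv O n f) := rfl

theorem coeff_restrictZero (f : MvPowerSeries (Fin (n + 1)) O) (k : ℕ) :
    PowerSeries.coeff k (restrictZero O n f) = coeff (Finsupp.cons k 0) f := by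
  rw [restrictZero_apply, PowerSeries.coeff_map, ← coeff_zero_eq_constantCoeff_apply,
    coeff_coeff_finSuccEquiv]

theorem restrictZero_shear (D : ℕ) (i : Fin (n + 1)) :
    restrictZero O n (shear O n D 1 i) = PowerSeries.X ^ (D ^ (i : ℕ)) := by
  rw [restrictZero_apply]
  refine Fin.cases ?_ (fun i => ?_) i <;> simp [shear]

/-- Once the other variables are set to zero, the sheared monomial `X ^ e` becomes `X_0` to the
power `∑ e i * D ^ i`. -/
theorem coeff_smul_coeff_prod_shear (D : ℕ) (f : MvPowerSeries (Fin (n + 1)) O) (k : ℕ)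
    (e : Fin (n + 1) →₀ ℕ) :
    coeff e f • coeff (Finsupp.cons k 0) (e.prod fun s m => shear O n D 1 s ^ m) =
      if k = ∑ i, e i * D ^ (i : ℕ) then coeff e f else 0 := by
  rw [← coeff_restrictZero, Finsupp.prod_fintype _ _ (by simp), map_prod]
  simp only [map_pow, restrictZero_shear, ← pow_mul]
  rw [Finset.prod_pow_eq_pow_sum, PowerSeries.coeff_X_pow]
  simp only [mul_comm (D ^ _)]
  split_ifs <;> simp

theorem coeff_restrictZero_subst_shear {D : ℕ} (hD : 0 < D) (f : MvPowerSeries (Fin (n + 1)) O)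
    (k : ℕ) : PowerSeries.coeff k (restrictZero O n (subst (shear O n D 1) f)) =
      ∑ᶠ e : Fin (n + 1) →₀ ℕ, if k = ∑ i, e i * D ^ (i : ℕ) then coeff e f else 0 := by
  rw [coeff_restrictZero, coeff_subst (hasSubst_shear hD 1)]
  exact finsum_congr fun e => coeff_smul_coeff_prod_shear D f k e

theorem hasFiniteSupport_weight {D : ℕ} (hD : 0 < D) (f : MvPowerSeries (Fin (n + 1)) O) (k : ℕ) :
    (fun e : Fin (n + 1) →₀ ℕ =>
      if k = ∑ i, e i * D ^ (i : ℕ) then coeff e f else 0).HasFiniteSupport := by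
  simp only [← coeff_smul_coeff_prod_shear]
  exact coeff_subst_finite (hasSubst_shear hD 1) f _

/-- Choose `D` so that exactly one exponent with unit coefficient has least weight `k`. All other
exponents of weight `k` have coefficients in the maximal ideal, so the `k`-th coefficient has
nonzero residue. -/
theorem exists_isUnit_coeff_restrictZero [IsLocalRing O] {f : MvPowerSeries (Fin (n + 1)) O}
    {d : Fin (n + 1) →₀ ℕ} (hf : IsUnit (coeff d f)) :
    ∃ (D : ℕ) (hD : 0 < D) (k : ℕ),
      IsUnit (PowerSeries.coeff k (restrictZero O n (shearEquiv O n hD f))) := by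
  classical
  obtain ⟨d, hd, D₀, h⟩ := exists_unique_minimal_weight (n + 1)
    {e | IsUnit (coeff (Finsupp.equivFunOnFinite.symm e) f)}
    ⟨d, by simpa using hf⟩
  refine ⟨D₀ + 1, Nat.succ_pos _, ∑ i, d i * (D₀ + 1) ^ (i : ℕ), ?_⟩
  obtain ⟨-, h⟩ := h (D₀ + 1) (Nat.le_succ _)
  have key := coeff_restrictZero_subst_shear (Nat.succ_pos D₀) f
    (∑ i, d i * (D₀ + 1) ^ (i : ℕ))
  change IsUnit (PowerSeries.coeff _ (restrictZero O n (subst (shear O n (D₀ + 1) 1) f)))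
  rw [key, ← IsLocalRing.residue_ne_zero_iff_isUnit]
  refine (((IsLocalRing.residue O).toAddMonoidHom.map_finsum
    (hasFiniteSupport_weight (Nat.succ_pos D₀) f _)).trans (finsum_eq_single _
    (Finsupp.equivFunOnFinite.symm d) fun e he => ?_)).trans_ne ?_
  · split_ifs with hw
    · have hnu : ¬ IsUnit (coeff e f) := fun hu => he (by
        rw [← h e (by simpa using hu) hw.ge]
        simp)
      exact (IsLocalRing.residue_eq_zero_iff _).2 hnu
    · exact map_zero _
  · simpa using hd

theorem map_residue_finSuccEquiv_ne_zero [IsLocalRing O] {f : MvPowerSeries (Fin (n + 1)) O} {k : ℕ}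
    (h : IsUnit (PowerSeries.coeff k (restrictZero O n f))) :
    (finSuccEquiv O n f).map (IsLocalRing.residue (MvPowerSeries (Fin n) O)) ≠ 0 := by
  intro h0
  have h1 := congrArg (PowerSeries.coeff k) h0
  rw [PowerSeries.coeff_map, map_zero, IsLocalRing.residue_eq_zero_iff,
    IsLocalRing.mem_maximalIdeal, mem_nonunits_iff] at h1
  apply h1
  rw [restrictZero_apply, PowerSeries.coeff_map] at h
  exact isUnit_iff_constantCoeff.2 h

end ChangeOfVariables

/-! ### Unique factorisation in finitely many variables. -/

section FiniteUFD

open MvPowerSeries IsLocalRing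

variable (O : Type*) [CommRing O] [IsDomain O] [IsDiscreteValuationRing O]

instance isDomain_mvPowerSeries (σ : Type*) : IsDomain (MvPowerSeries σ O) :=
  NoZeroDivisors.to_isDomain _

variable {O} in
-- A coefficient of least valuation divides all the others.
theorem exists_eq_C_mul_of_ne_zero {σ : Type*} {f : MvPowerSeries σ O} (hf : f ≠ 0) :
    ∃ (a : O) (g : MvPowerSeries σ O) (d : σ →₀ ℕ), a ≠ 0 ∧ coeff d g = 1 ∧ f = C a * g := by
  obtain ⟨d, -, hd⟩ := WellFounded.has_min (InvImage.wf
    (fun d => IsDiscreteValuationRing.addVal O (coeff d f)) (wellFounded_lt (α := ℕ∞)))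
    Set.univ ⟨0, trivial⟩
  have hdvd : ∀ e, coeff d f ∣ coeff e f := fun e => by
    rw [← IsDiscreteValuationRing.addVal_le_iff_dvd]
    exact not_lt.1 (hd e trivial)
  obtain ⟨g, hg⟩ : ∃ g : MvPowerSeries σ O, ∀ e, coeff e f = coeff d f * coeff e g := by
    choose g hg using hdvd
    exact ⟨g, hg⟩
  have h0 : coeff d f ≠ 0 := by
    intro h0
    apply hf
    ext e
    rw [hg e, h0, zero_mul, map_zero]
  refine ⟨coeff d f, g, d, h0, mul_left_cancel₀ h0 ((hg d).symm.trans (mul_one _).symm), ?_⟩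
  ext e
  rw [coeff_C_mul]
  exact hg e

theorem ufd_mvPowerSeries_fin [IsAdicComplete (maximalIdeal O) O] (n : ℕ) :
    UniqueFactorizationMonoid (MvPowerSeries (Fin n) O) := by
  induction n with
  | zero =>
    exact (isEmptyEquiv (Fin 0) O).toRingEquiv.toMulEquiv.symm.uniqueFactorizationMonoid
      inferInstance
  | succ n ih =>
    refine ufd_of_hasPrimeFactors fun f hf => ?_
    obtain ⟨a, g, d, ha, hg, rfl⟩ := exists_eq_C_mul_of_ne_zero hf
    refine HasPrimeFactors.mul ?_ ?_
    · obtain ⟨s, hs, hsa⟩ := hasPrimeFactors_of_ufd ha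
      exact hasPrimeFactors_map_of_prime C hsa fun b hb => prime_C (hs b hb)
    · obtain ⟨D, hD, k, h⟩ := exists_isUnit_coeff_restrictZero (hg ▸ isUnit_one)
      refine HasPrimeFactors.of_ringEquiv (shearEquiv O n hD) ?_
      refine HasPrimeFactors.of_ringEquiv (finSuccEquiv O n).toRingEquiv ?_
      exact hasPrimeFactors_of_map_residue_ne_zero (map_residue_finSuccEquiv_ne_zero h)

end FiniteUFD

/-! ### Counting irreducible factors. -/

section FactorLength

open UniqueFactorizationMonoid

variable {D : Type*} [CommRing D] [UniqueFactorizationMonoid D]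

/-- The number of irreducible factors of an element of a unique factorisation domain. -/
def factorLength (a : D) : ℕ := (factors a).card

theorem factorLength_mul {a b : D} (ha : a ≠ 0) (hb : b ≠ 0) :
    factorLength (a * b) = factorLength a + factorLength b := by
  rw [factorLength, Multiset.card_eq_card_of_rel (factors_mul ha hb), Multiset.card_add]
  rfl

theorem factorLength_eq_of_associated {a b : D} (h : Associated a b) :
    factorLength a = factorLength b :=
  Multiset.card_eq_card_of_rel (factors_rel_of_associated h)

theorem factorLength_pos {a : D} (ha : a ≠ 0) (hu : ¬ IsUnit a) : 0 < factorLength a := by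
  rw [factorLength, Multiset.card_pos]
  intro h
  have := factors_prod ha
  rw [h, Multiset.prod_zero] at this
  exact hu (associated_one_iff_isUnit.1 this.symm)

theorem irreducible_of_factorLength_eq_one {a : D} (ha : a ≠ 0) (h : factorLength a = 1) :
    Irreducible a := by
  obtain ⟨q, hq⟩ := Multiset.card_eq_one.1 h
  have := factors_prod ha
  rw [hq, Multiset.prod_singleton] at this
  exact this.irreducible (irreducible_of_factor q (by rw [hq]; exact Multiset.mem_singleton_self q))

/-- Each nonzero nonunit contributes at least one irreducible factor; the equality case is what
detects irreducibility in the limit argument. -/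
theorem card_le_factorLength_prod [IsDomain D] (s : Multiset D) (hs : ∀ a ∈ s, a ≠ 0 ∧ ¬ IsUnit a) :
    s.card ≤ factorLength s.prod ∧
      (s.card = factorLength s.prod → ∀ a ∈ s, Irreducible a) := by
  induction s using Multiset.induction_on with
  | empty => simp
  | cons a s ih =>
    have ha := hs a (Multiset.mem_cons_self a s)
    have hs' : ∀ b ∈ s, b ≠ 0 ∧ ¬ IsUnit b := fun b hb => hs b (Multiset.mem_cons_of_mem hb)
    obtain ⟨h1, h2⟩ := ih hs'
    have hp : s.prod ≠ 0 := Multiset.prod_ne_zero fun h => (hs' 0 h).1 rfl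
    have hpos := factorLength_pos ha.1 ha.2
    rw [Multiset.prod_cons, Multiset.card_cons, factorLength_mul ha.1 hp]
    refine ⟨by omega, fun heq b hb => ?_⟩
    rcases Multiset.mem_cons.1 hb with rfl | hb
    · exact irreducible_of_factorLength_eq_one ha.1 (by omega)
    · exact h2 (by omega) b hb

end FactorLength

/-! ### Unique factorisation in an inverse limit. -/

section InverseLimitUFD

open UniqueFactorizationMonoid

variable {B : ℕ → Type u} [∀ n, CommRing (B n)]
  {A : Type v} [CommRing A] {φ : ∀ n, B (n + 1) →+* B n} {π : ∀ n, A →+* B n}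

theorem proj_eq_of_le (hφ : ∀ n x, φ n (π (n + 1) x) = π n x) {m n : ℕ} (hmn : m ≤ n) {x y : A}
    (h : π n x = π n y) : π m x = π m y := by
  induction n, hmn using Nat.le_induction with
  | base => exact h
  | succ n hmn ih => exact ih (by rw [← hφ, h, hφ])

theorem proj_dvd_of_le (hφ : ∀ n x, φ n (π (n + 1) x) = π n x)
    (hsurj : ∀ n, Function.Surjective (π n)) {m n : ℕ} (hmn : m ≤ n) {x y : A}
    (h : π n x ∣ π n y) : π m x ∣ π m y := by
  obtain ⟨z, hz⟩ := h
  obtain ⟨z, rfl⟩ := hsurj n z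
  rw [← map_mul] at hz
  exact ⟨π m z, by rw [← map_mul]; exact proj_eq_of_le hφ hmn hz⟩

theorem exists_limit_of_compatible
    (hlim : ∀ F : ℕ → A, (∀ n, π n (F (n + 1)) = π n (F n)) → ∃ a, ∀ n, π n a = π n (F n))
    (N : ℕ) (F : ℕ → A) (hF : ∀ k, π (N + k) (F (k + 1)) = π (N + k) (F k)) :
    ∃ a, ∀ k, π (N + k) a = π (N + k) (F k) := by
  -- Truncated subtraction makes the sequence constant below level `N`, where no compatibility is
  -- assumed.
  obtain ⟨a, ha⟩ := hlim (fun m => F (m - N)) fun m => by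
    rcases lt_or_ge m N with h | h
    · rw [show m + 1 - N = 0 by omega, show m - N = 0 by omega]
    · obtain ⟨k, rfl⟩ := Nat.exists_eq_add_of_le h
      rw [show N + k + 1 - N = k + 1 by omega, show N + k - N = k by omega]
      exact hF k
  refine ⟨a, fun k => ?_⟩
  have := ha (N + k)
  rwa [Nat.add_sub_cancel_left] at this

variable [∀ n, IsDomain (B n)]

/-- Quotients in a domain are unique, so those at the various levels are compatible and have a
limit. -/
theorem dvd_of_forall_proj_dvd (hφ : ∀ n x, φ n (π (n + 1) x) = π n x)
    (hsurj : ∀ n, Function.Surjective (π n))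
    (hext : ∀ x y : A, (∀ n, π n x = π n y) → x = y)
    (hlim : ∀ F : ℕ → A, (∀ n, π n (F (n + 1)) = π n (F n)) → ∃ a, ∀ n, π n a = π n (F n))
    {N : ℕ} {x y : A} (hx : ∀ k, π (N + k) x ≠ 0) (h : ∀ k, π (N + k) x ∣ π (N + k) y) :
    x ∣ y := by
  have : ∀ k, ∃ q, π (N + k) (x * q) = π (N + k) y := fun k => by
    obtain ⟨q, hq⟩ := h k
    obtain ⟨q, rfl⟩ := hsurj _ q
    exact ⟨q, by rw [map_mul, hq]⟩
  choose F hF using this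
  obtain ⟨q, hq⟩ := exists_limit_of_compatible hlim N F fun k => by
    apply mul_left_cancel₀ (hx k)
    rw [← map_mul, ← map_mul, hF]
    exact proj_eq_of_le hφ (Nat.le_succ _) (hF (k + 1))
  refine ⟨q, hext _ _ fun n => proj_eq_of_le hφ (Nat.le_add_left n N) ?_⟩
  rw [← hF, map_mul, map_mul, hq]

/-- If `g` fails to divide `a` at one level, it fails at all higher levels, where primality makes it
divide `b`; divisibility descends to lower levels. -/
theorem prime_of_forall_proj_prime (hφ : ∀ n x, φ n (π (n + 1) x) = π n x)
    (hsurj : ∀ n, Function.Surjective (π n))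
    (hext : ∀ x y : A, (∀ n, π n x = π n y) → x = y)
    (hlim : ∀ F : ℕ → A, (∀ n, π n (F (n + 1)) = π n (F n)) → ∃ a, ∀ n, π n a = π n (F n))
    {N : ℕ} {g : A} (hg : ∀ k, Prime (π (N + k) g)) : Prime g := by
  refine ⟨fun h => (hg 0).ne_zero (by rw [h, map_zero]), fun h => (hg 0).not_isUnit (h.map _),
    fun a b hab => ?_⟩
  have hdvd : ∀ c, (∀ k, π (N + k) g ∣ π (N + k) c) → g ∣ c := fun c =>
    dvd_of_forall_proj_dvd hφ hsurj hext hlim fun k => (hg k).ne_zero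
  by_cases h : ∀ k, π (N + k) g ∣ π (N + k) a
  · exact .inl (hdvd a h)
  · right
    push Not at h
    obtain ⟨k₀, h⟩ := h
    refine hdvd b fun k => proj_dvd_of_le hφ hsurj (n := N + max k k₀) (by omega) ?_
    have hd := map_dvd (π (N + max k k₀)) hab
    rw [map_mul] at hd
    refine ((hg _).dvd_or_dvd hd).resolve_left fun h' => h ?_
    exact proj_dvd_of_le hφ hsurj (by omega) h'

variable [∀ n, UniqueFactorizationMonoid (B n)]

/-- Factors at level `n + 1` map to nonzero nonunits with product associated to the image of `f` at
level `n`, so the factor count is nonincreasing. Where it is constant, irreducible factors map to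
irreducibles, and one irreducible factor can be lifted through all levels. -/
theorem exists_prime_dvd_of_inverseLimit (hφ : ∀ n x, φ n (π (n + 1) x) = π n x)
    (hsurj : ∀ n, Function.Surjective (π n)) (hloc : ∀ n x, IsUnit (π n x) → IsUnit x)
    (hext : ∀ x y : A, (∀ n, π n x = π n y) → x = y)
    (hlim : ∀ F : ℕ → A, (∀ n, π n (F (n + 1)) = π n (F n)) → ∃ a, ∀ n, π n a = π n (F n))
    {f : A} {N : ℕ} (hf : ∀ k, π (N + k) f ≠ 0) (hu : ¬ IsUnit f) :
    ∃ g, Prime g ∧ g ∣ f := by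
  have hφloc : ∀ n x, IsUnit (φ n x) → IsUnit x := fun n x hx => by
    obtain ⟨x, rfl⟩ := hsurj _ x
    rw [hφ] at hx
    exact (hloc _ _ hx).map _
  have hφu : ∀ n, ∀ t ∈ factors (π (n + 1) f), ¬ IsUnit (φ n t) := fun n t ht h =>
    (irreducible_of_factor t ht).not_isUnit (hφloc _ _ h)
  have hassoc : ∀ k, Associated ((factors (π (N + (k + 1)) f)).map (φ (N + k))).prod
      (π (N + k) f) := fun k => by
    rw [Multiset.prod_hom]
    have h := (factors_prod (hf (k + 1))).map (φ (N + k))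
    rwa [show φ (N + k) (π (N + (k + 1)) f) = π (N + k) f from hφ _ _] at h
  have hφ0 : ∀ k, ∀ t ∈ factors (π (N + (k + 1)) f), φ (N + k) t ≠ 0 := fun k t ht h => by
    have : ((factors (π (N + (k + 1)) f)).map (φ (N + k))).prod = 0 :=
      Multiset.prod_eq_zero (h ▸ Multiset.mem_map_of_mem _ ht)
    have h1 := hassoc k
    rw [this] at h1
    exact hf k ((associated_zero_iff_eq_zero _).1 h1.symm)
  have hcard : ∀ k, factorLength (π (N + (k + 1)) f) ≤ factorLength (π (N + k) f) ∧
      (factorLength (π (N + (k + 1)) f) = factorLength (π (N + k) f) →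
        ∀ t ∈ factors (π (N + (k + 1)) f), Irreducible (φ (N + k) t)) := fun k => by
    have h := card_le_factorLength_prod ((factors (π (N + (k + 1)) f)).map (φ (N + k)))
      fun a ha => by
        obtain ⟨t, ht, rfl⟩ := Multiset.mem_map.1 ha
        exact ⟨hφ0 k t ht, hφu _ t ht⟩
    rw [Multiset.card_map, factorLength_eq_of_associated (hassoc k)] at h
    exact ⟨h.1, fun heq t ht => h.2 heq _ (Multiset.mem_map_of_mem _ ht)⟩
  obtain ⟨M, hM⟩ : ∃ M, ∀ k, M ≤ k →
      factorLength (π (N + M) f) = factorLength (π (N + k) f) := by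
    obtain ⟨M, hM⟩ := WellFoundedGT.monotone_chain_condition
      (⟨fun k => OrderDual.toDual (factorLength (π (N + k) f)),
        monotone_nat_of_le_succ fun k => (hcard k).1⟩ : ℕ →o ℕᵒᵈ)
    exact ⟨M, fun k hk => hM k hk⟩
  have hirr : ∀ k, ∀ t ∈ factors (π (N + (M + k + 1)) f), Irreducible (φ (N + (M + k)) t) :=
    fun k => (hcard (M + k)).2 ((hM _ (by omega)).symm.trans (hM _ (by omega)))
  let Good : ℕ → A → Prop := fun k a =>
    Irreducible (π (N + (M + k)) a) ∧ π (N + (M + k)) a ∣ π (N + (M + k)) f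
  have h0 : ∃ a, Good 0 a := by
    obtain ⟨g, hg, hgf⟩ := WfDvdMonoid.exists_irreducible_factor
      (fun h => hu (hloc (N + (M + 0)) _ h)) (hf (M + 0))
    obtain ⟨a, rfl⟩ := hsurj _ g
    exact ⟨a, hg, hgf⟩
  have hstep : ∀ k a, Good k a → ∃ b, Good (k + 1) b ∧
      π (N + (M + k)) b = π (N + (M + k)) a := by
    rintro k a ⟨ha, haf⟩
    have hd := haf.trans (hassoc (M + k)).symm.dvd
    obtain ⟨b, hb, hab⟩ := (irreducible_iff_prime.1 ha).exists_mem_multiset_dvd hd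
    obtain ⟨t, ht, rfl⟩ := Multiset.mem_map.1 hb
    obtain ⟨u, hu⟩ := (ha.associated_of_dvd (hirr k t ht) hab).symm
    -- The lifted factor reduces to the given one only up to a unit; lifting that unit gives exact
    -- compatibility.
    obtain ⟨v, hv⟩ := hsurj _ (u : B (N + (M + k)))
    have hv' : IsUnit v := hloc (N + (M + k)) v (hv ▸ u.isUnit)
    obtain ⟨t, rfl⟩ := hsurj _ t
    have hass : Associated (π (N + (M + k + 1)) t) (π (N + (M + k + 1)) (t * v)) := by
      rw [map_mul]
      exact associated_mul_unit_right _ _ (hv'.map _)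
    refine ⟨t * v, ⟨hass.irreducible (irreducible_of_factor _ ht),
      hass.symm.dvd.trans (dvd_of_mem_factors ht)⟩, ?_⟩
    rw [map_mul, hv, ← hu]
    congr 1
    exact (hφ _ _).symm
  obtain ⟨a₀, ha₀⟩ := h0
  choose! next hnext using hstep
  let F : ℕ → A := fun k => Nat.rec a₀ next k
  have hF : ∀ k, Good k (F k) := fun k => by
    induction k with
    | zero => exact ha₀
    | succ k ih => exact (hnext k _ ih).1
  obtain ⟨g, hg⟩ := exists_limit_of_compatible hlim (N + M) F fun k => by
    rw [add_assoc]
    exact (hnext k _ (hF k)).2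
  replace hg : ∀ k, π (N + (M + k)) g = π (N + (M + k)) (F k) := fun k => by
    have := hg k
    rwa [add_assoc] at this
  have hprime : ∀ k, Prime (π (N + M + k) g) := fun k => by
    rw [add_assoc, hg]
    exact irreducible_iff_prime.1 (hF k).1
  refine ⟨g, prime_of_forall_proj_prime hφ hsurj hext hlim hprime,
    dvd_of_forall_proj_dvd hφ hsurj hext hlim (fun k => (hprime k).ne_zero) fun k => ?_⟩
  rw [add_assoc, hg]
  exact (hF k).2

/-- An inverse limit of unique factorisation domains along local homomorphisms is a unique
factorisation domain. -/
theorem ufd_of_inverseLimit [IsDomain A] (hφ : ∀ n x, φ n (π (n + 1) x) = π n x)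
    (hsurj : ∀ n, Function.Surjective (π n)) (hloc : ∀ n x, IsUnit (π n x) → IsUnit x)
    (hext : ∀ x y : A, (∀ n, π n x = π n y) → x = y)
    (hlim : ∀ F : ℕ → A, (∀ n, π n (F (n + 1)) = π n (F n)) → ∃ a, ∀ n, π n a = π n (F n)) :
    UniqueFactorizationMonoid A := by
  refine ufd_of_hasPrimeFactors fun f hf => ?_
  obtain ⟨N, hN⟩ : ∃ N, π N f ≠ 0 := by
    by_contra! h
    exact hf (hext _ _ fun n => by rw [h, map_zero])
  -- Induction at one fixed level `N`: a prime factor stays a nonunit there, so splitting it off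
  -- lowers the count.
  induction hl : factorLength (π N f) using Nat.strong_induction_on generalizing f with
  | _ l ih =>
    by_cases hu : IsUnit f
    · exact ⟨0, by simp, by simpa using (associated_one_iff_isUnit.2 hu).symm⟩
    · have hk : ∀ k, π (N + k) f ≠ 0 := fun k h => hN (by
        rw [← map_zero (π (N + k))] at h
        rw [proj_eq_of_le hφ (Nat.le_add_right N k) h, map_zero])
      obtain ⟨g, hg, q, rfl⟩ := exists_prime_dvd_of_inverseLimit hφ hsurj hloc hext hlim hk hu
      have hgq := hN
      rw [map_mul] at hgq
      have h1 := left_ne_zero_of_mul hgq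
      have h2 := right_ne_zero_of_mul hgq
      rw [map_mul, factorLength_mul h1 h2] at hl
      have hpos := factorLength_pos h1 fun h => hg.not_isUnit (hloc _ _ h)
      refine HasPrimeFactors.mul ⟨{g}, by simpa using hg, by simp⟩
        (ih _ (by omega) _ (right_ne_zero_of_mul hf) h2 rfl)

end InverseLimitUFD

/-! ### Unique factorisation in countably many variables. -/

section InfiniteUFD

open MvPowerSeries IsLocalRing

variable {S : Type*} [CommRing S]

theorem coeff_eq_coeff_killCompl {n : ℕ} {e : ℕ →₀ ℕ} (he : ∀ i, n ≤ i → e i = 0) :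
    ∃ x : Fin n →₀ ℕ, ∀ f : MvPowerSeries ℕ S,
      coeff x (killCompl (Fin.valEmbedding : Fin n ↪ ℕ) f) = coeff e f := by
  obtain ⟨x, hx⟩ := (Finsupp.mem_range_embDomain_iff (Fin.valEmbedding : Fin n ↪ ℕ) e).2 fun i hi =>
    ⟨⟨i, by
      by_contra h
      exact Finsupp.mem_support_iff.1 hi (he i (not_lt.1 h))⟩, rfl⟩
  exact ⟨x, fun f => by rw [coeff_killCompl, hx]⟩

theorem exists_killCompl_limit (F : ℕ → MvPowerSeries ℕ S)
    (hF : ∀ n, killCompl (Fin.valEmbedding : Fin n ↪ ℕ) (F (n + 1)) =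
      killCompl Fin.valEmbedding (F n)) :
    ∃ a, ∀ n, killCompl (Fin.valEmbedding : Fin n ↪ ℕ) a = killCompl Fin.valEmbedding (F n) := by
  have hstep : ∀ (e : ℕ →₀ ℕ) (m n : ℕ), m ≤ n → (∀ i, m ≤ i → e i = 0) →
      coeff e (F n) = coeff e (F m) := by
    intro e m n hmn he
    induction n, hmn using Nat.le_induction with
    | base => rfl
    | succ n hmn ih =>
      obtain ⟨x, hx⟩ := coeff_eq_coeff_killCompl (S := S) (n := n) fun i hi => he i (hmn.trans hi)
      rw [← ih, ← hx, hF, hx]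
  have hbound : ∀ e : ℕ →₀ ℕ, ∃ N, ∀ i, N ≤ i → e i = 0 := fun e => by
    obtain ⟨N, hN⟩ := e.support.bddAbove
    refine ⟨N + 1, fun i hi => ?_⟩
    by_contra h
    exact absurd (hN (Finsupp.mem_support_iff.2 h)) (by omega)
  choose N hN using hbound
  refine ⟨(show MvPowerSeries ℕ S from fun e => coeff e (F (N e))), fun n => ?_⟩
  ext x
  rw [coeff_killCompl, coeff_killCompl]
  set e := x.embDomain (Fin.valEmbedding : Fin n ↪ ℕ) with he
  change coeff e (F (N e)) = _
  have hn : ∀ i, n ≤ i → e i = 0 := fun i hi => by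
    rw [he, Finsupp.embDomain_of_notMem_range]
    rintro ⟨j, hj⟩
    have : (j : ℕ) = i := hj
    omega
  rcases le_total n (N e) with h | h
  · exact hstep e n (N e) h hn
  · exact (hstep e (N e) n h (hN e)).symm

theorem ufd_mvPowerSeries_nat (O : Type*) [CommRing O] [IsDomain O] [IsDiscreteValuationRing O]
    [IsAdicComplete (maximalIdeal O) O] : UniqueFactorizationMonoid (MvPowerSeries ℕ O) := by
  have := ufd_mvPowerSeries_fin O
  refine ufd_of_inverseLimit (B := fun n => MvPowerSeries (Fin n) O)
    (φ := fun n => (killCompl (R := O) (Fin.castSuccEmb : Fin n ↪ Fin (n + 1))).toRingHom)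
    (π := fun n => (killCompl (R := O) (Fin.valEmbedding : Fin n ↪ ℕ)).toRingHom)
    (fun n f => ?_) (fun n f => ⟨rename Fin.valEmbedding f, killCompl_rename_app f⟩)
    (fun n f hf => ?_) (fun f g h => ?_) fun F hF => exists_killCompl_limit F hF
  · ext x
    change coeff x (killCompl _ (killCompl _ f)) = coeff x (killCompl _ f)
    rw [coeff_killCompl, coeff_killCompl, coeff_killCompl]
    simp only [Finsupp.embDomain_eq_mapDomain, ← Finsupp.mapDomain_comp]
    rfl
  -- Units are detected by the constant term, which survives killing variables.
  · rw [isUnit_iff_constantCoeff] at hf ⊢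
    have : constantCoeff (killCompl (Fin.valEmbedding : Fin n ↪ ℕ) f) = constantCoeff f := by
      rw [← coeff_zero_eq_constantCoeff_apply, coeff_killCompl, Finsupp.embDomain_zero,
        coeff_zero_eq_constantCoeff_apply]
    rwa [← this]
  · ext e
    obtain ⟨N, hN⟩ := e.support.bddAbove
    obtain ⟨x, hx⟩ := coeff_eq_coeff_killCompl (S := O) (n := N + 1) (e := e) fun i hi => by
      by_contra h
      exact absurd (hN (Finsupp.mem_support_iff.2 h)) (by omega)
    rw [← hx, ← hx]
    exact congrArg (coeff x) (h (N + 1))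

end InfiniteUFD

/-! ### Decomposition of `ℤ_p[G]` for `p` prime to the order of `G`. -/

section WittVectors

variable (p : ℕ) [Fact p.Prime]

instance (k : Type*) [Field k] [CharP k p] [PerfectRing k p] :
    IsAdicComplete (IsLocalRing.maximalIdeal (WittVector p k)) (WittVector p k) := by
  rw [(WittVector.irreducible p (k := k)).maximalIdeal_eq]
  infer_instance

/-- Reduction modulo `p` on the `p`-adic integers, through Witt vectors. -/
def reductionModP : ℤ_[p] →+* ZMod p :=
  WittVector.constantCoeff.comp (WittVector.equiv p).symm.toRingHom

theorem reductionModP_surjective : Function.Surjective (reductionModP p) :=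
  (WittVector.constantCoeff_surjective p).comp (WittVector.equiv p).symm.surjective

theorem reductionModP_eq_zero_iff (r : ℤ_[p]) : reductionModP p r = 0 ↔ (p : ℤ_[p]) ∣ r := by
  have h := WittVector.mem_span_p_iff_coeff_zero_eq_zero (p := p) (k := ZMod p)
    ((WittVector.equiv p).symm r)
  rw [Ideal.mem_span_singleton, ← map_natCast (WittVector.equiv p).symm,
    map_dvd_iff (WittVector.equiv p).symm] at h
  exact h.symm

variable (G : Type u) [CommGroup G]

/-- A residue field of `F_p[G]`. -/
abbrev groupRingResidueField (m : MaximalSpectrum (MonoidAlgebra (ZMod p) G)) : Type u :=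
  MonoidAlgebra (ZMod p) G ⧸ m.asIdeal

variable {G} in
instance (m : MaximalSpectrum (MonoidAlgebra (ZMod p) G)) : Field (groupRingResidueField p G m) :=
  Ideal.Quotient.field _

instance (m : MaximalSpectrum (MonoidAlgebra (ZMod p) G)) : CharP (groupRingResidueField p G m) p :=
  charP_of_injective_algebraMap (algebraMap (ZMod p) _).injective p

instance [Finite G] : Finite (MonoidAlgebra (ZMod p) G) :=
  Finite.of_injective (fun a => (a.coeff : G → ZMod p)) fun _ _ h =>
    MonoidAlgebra.ext (DFunLike.coe_injective h)

instance [Finite G] (m : MaximalSpectrum (MonoidAlgebra (ZMod p) G)) :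
    PerfectRing (groupRingResidueField p G m) p := by
  have : Finite (groupRingResidueField p G m) :=
    Finite.of_surjective _ (Ideal.Quotient.mk_surjective (I := m.asIdeal))
  infer_instance

/-- The map from `Z_p[G]` to the Witt vectors of a residue field of `F_p[G]`. -/
def wittLift (m : MaximalSpectrum (MonoidAlgebra (ZMod p) G)) :
    MonoidAlgebra ℤ_[p] G →+* WittVector p (groupRingResidueField p G m) :=
  MonoidAlgebra.liftNCRingHom
    ((WittVector.map (algebraMap (ZMod p) (groupRingResidueField p G m))).comp
      (WittVector.equiv p).symm.toRingHom)
    ((WittVector.teichmuller p).comp ((Ideal.Quotient.mk m.asIdeal).toMonoidHom.comp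
      (MonoidAlgebra.of (ZMod p) G))) fun _ _ => Commute.all _ _

/-- It suffices to compare on scalars and on group elements; a Teichmüller lift has the original
element as constant coefficient. -/
theorem constantCoeff_wittLift (m : MaximalSpectrum (MonoidAlgebra (ZMod p) G))
    (a : MonoidAlgebra ℤ_[p] G) : WittVector.constantCoeff (wittLift p G m a) =
      Ideal.Quotient.mk m.asIdeal (MonoidAlgebra.mapRingHom G (reductionModP p) a) := by
  have h : WittVector.constantCoeff.comp (wittLift p G m) = (Ideal.Quotient.mk m.asIdeal).comp
      (MonoidAlgebra.mapRingHom G (reductionModP p)) := by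
    refine MonoidAlgebra.ringHom_ext (fun r => ?_) fun g => ?_
    · rw [RingHom.comp_apply, RingHom.comp_apply, MonoidAlgebra.mapRingHom_single, wittLift,
        MonoidAlgebra.liftNCRingHom_single, map_one, mul_one]
      rfl
    · rw [RingHom.comp_apply, RingHom.comp_apply, MonoidAlgebra.mapRingHom_single, wittLift,
        MonoidAlgebra.liftNCRingHom_single, map_one, map_one, one_mul]
      exact WittVector.teichmuller_coeff_zero p _
  exact RingHom.congr_fun h a

variable [Finite G]

theorem mapRingHom_reductionModP_eq_zero_iff (a : MonoidAlgebra ℤ_[p] G) :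
    MonoidAlgebra.mapRingHom G (reductionModP p) a = 0 ↔ (p : MonoidAlgebra ℤ_[p] G) ∣ a := by
  have h : ∀ b : MonoidAlgebra ℤ_[p] G, ∀ g, (p * b).coeff g = p * b.coeff g := fun b g => by
    rw [← nsmul_eq_mul, ← nsmul_eq_mul]
    rfl
  constructor
  · intro ha
    have hdvd : ∀ g, (p : ℤ_[p]) ∣ a.coeff g := fun g => by
      rw [← reductionModP_eq_zero_iff, ← MonoidAlgebra.coeff_mapRingHom, ha]
      rfl
    choose z hz using hdvd
    refine ⟨.ofCoeff (Finsupp.equivFunOnFinite.symm z), MonoidAlgebra.ext (Finsupp.ext fun g => ?_)⟩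
    rw [h, hz]
    rfl
  · rintro ⟨b, rfl⟩
    refine MonoidAlgebra.ext (Finsupp.ext fun g => ?_)
    rw [MonoidAlgebra.coeff_mapRingHom, h, (reductionModP_eq_zero_iff p _).2 (dvd_mul_right _ _)]
    rfl

/-- Modulo `p` the map is the decomposition of the reduced artinian ring `F_p[G]` into fields.
Bijectivity lifts because the source is `p`-adically complete and the target is `p`-torsion-free and
`p`-adically separated. -/
theorem bijective_pi_wittLift (hG : ¬ p ∣ Nat.card G) :
    Function.Bijective (RingHom.pi (wittLift p G)) := by
  have : NeZero (Nat.card G : ZMod p) := ⟨by rwa [Ne, ZMod.natCast_eq_zero_iff]⟩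
  have hss : IsSemisimpleRing (MonoidAlgebra (ZMod p) G) := inferInstance
  have hred : IsReduced (MonoidAlgebra (ZMod p) G) := inferInstance
  have hart : IsArtinianRing (MonoidAlgebra (ZMod p) G) := inferInstance
  let θ := RingHom.pi (wittLift p G)
  have hcc : ∀ a, (fun m => WittVector.constantCoeff (θ a m)) =
      IsArtinianRing.equivPi _ (MonoidAlgebra.mapRingHom G (reductionModP p) a) := fun a =>
    funext fun m => constantCoeff_wittLift p G m a
  have hdvd : ∀ n (x : Π m, WittVector p (groupRingResidueField p G m)),
      (p : Π m, WittVector p (groupRingResidueField p G m)) ^ n ∣ x ↔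
        ∀ m, (p : WittVector p (groupRingResidueField p G m)) ^ n ∣ x m := fun n x => by
    rw [pi_dvd_iff]
    rfl
  have : IsAdicComplete (Ideal.span {(p : MonoidAlgebra ℤ_[p] G)}) (MonoidAlgebra ℤ_[p] G) :=
    isAdicComplete_span_natCast_of_addEquiv p (MonoidAlgebra.coeffAddEquiv.trans
      (Finsupp.linearEquivFunOnFinite ℤ_[p] ℤ_[p] G).toAddEquiv)
  constructor
  · rw [injective_iff_map_eq_zero]
    -- An element of the kernel is `p * b`, and `b` is again in the kernel, so it is divisible by
    -- every power of `p`.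
    have key : ∀ n a, θ a = 0 → (p : MonoidAlgebra ℤ_[p] G) ^ n ∣ a := by
      intro n
      induction n with
      | zero => simp
      | succ n ih =>
        intro a ha
        have h0 : MonoidAlgebra.mapRingHom G (reductionModP p) a = 0 := by
          apply (IsArtinianRing.equivPi (MonoidAlgebra (ZMod p) G)).injective
          rw [← hcc, map_zero, ha]
          exact funext fun m => map_zero _
        obtain ⟨b, rfl⟩ := (mapRingHom_reductionModP_eq_zero_iff p G a).1 h0
        rw [pow_succ']
        refine mul_dvd_mul_left _ (ih b (funext fun m => ?_))
        refine WittVector.eq_zero_of_p_mul_eq_zero _ ?_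
        have := congrFun ha m
        rw [map_mul, map_natCast, mul_comm] at this
        exact this
    intro a ha
    refine IsHausdorff.haus' (I := Ideal.span {(p : MonoidAlgebra ℤ_[p] G)}) _ fun n => ?_
    rw [smodEq_span_singleton_pow, sub_zero]
    exact key n a ha
  · have hmap : (Ideal.span {(p : MonoidAlgebra ℤ_[p] G)}).map θ = Ideal.span {(p : Π m,
        WittVector p (groupRingResidueField p G m))} := by
      rw [Ideal.map_span, Set.image_singleton, map_natCast]
    have : IsHausdorff ((Ideal.span {(p : MonoidAlgebra ℤ_[p] G)}).map θ)
        (Π m, WittVector p (groupRingResidueField p G m)) := by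
      rw [hmap]
      refine ⟨fun x hx => funext fun m => ?_⟩
      refine IsHausdorff.haus' (I := Ideal.span {(p : WittVector p (groupRingResidueField p G m))})
        _ fun n => ?_
      have := smodEq_span_singleton_pow.1 (hx n)
      rw [sub_zero, hdvd] at this
      rw [smodEq_span_singleton_pow, sub_zero]
      exact this m
    refine surjective_of_mk_map_comp_surjective (I := Ideal.span {(p : MonoidAlgebra ℤ_[p] G)}) θ
      fun y => ?_
    obtain ⟨t, rfl⟩ := Ideal.Quotient.mk_surjective y
    obtain ⟨b, hb⟩ := (IsArtinianRing.equivPi (MonoidAlgebra (ZMod p) G)).surjective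
      fun m => WittVector.constantCoeff (t m)
    obtain ⟨a, rfl⟩ : ∃ a, MonoidAlgebra.mapRingHom G (reductionModP p) a = b := by
      choose r hr using reductionModP_surjective p
      refine ⟨.ofCoeff (Finsupp.equivFunOnFinite.symm fun g => r (b.coeff g)), ?_⟩
      ext g
      rw [MonoidAlgebra.coeff_mapRingHom]
      exact hr _
    refine ⟨a, ?_⟩
    rw [RingHom.comp_apply, Ideal.Quotient.eq, hmap, Ideal.mem_span_singleton, ← pow_one
      (p : Π m, WittVector p (groupRingResidueField p G m)), hdvd]
    intro m
    rw [pow_one, ← Ideal.mem_span_singleton, WittVector.mem_span_p_iff_coeff_zero_eq_zero]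
    have := congrFun ((hcc a).trans hb) m
    rw [← sub_eq_zero, ← map_sub] at this
    exact this

/-- If `p` does not divide the order of `G`, then `Z_p[G]` is a finite product of rings of Witt
vectors of finite fields. -/
def groupRingWittEquiv (hG : ¬ p ∣ Nat.card G) :
    MonoidAlgebra ℤ_[p] G ≃+* Π m, WittVector p (groupRingResidueField p G m) :=
  RingEquiv.ofBijective _ (bijective_pi_wittLift p G hG)

end WittVectors

/-! ### Power series over products, and amenability of `A`. -/

section Products

open MvPowerSeries

variable {ι : Type*} {S : Type*} {T : ι → Type*} [CommRing S] [∀ i, CommRing (T i)]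

/-- Power series over a product are products of power series. -/
def mvPowerSeriesPiEquiv (σ : Type*) (e : S ≃+* Π i, T i) :
    MvPowerSeries σ S ≃+* Π i, MvPowerSeries σ (T i) :=
  RingEquiv.ofBijective
    (RingHom.pi fun i => MvPowerSeries.map ((Pi.evalRingHom T i).comp e.toRingHom)) <| by
    constructor
    · intro f g h
      ext d
      apply e.injective
      ext i
      exact congrArg (coeff d) (congrFun h i)
    · intro f
      refine ⟨(show MvPowerSeries σ S from fun d => e.symm fun i => coeff d (f i)), ?_⟩
      ext i d
      change e (e.symm fun i => coeff d (f i)) i = coeff d (f i)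
      rw [e.apply_symm_apply]

end Products

theorem isAmenableRing_Ainf (p : ℕ) [Fact p.Prime] (G : Type u) [CommGroup G] [Finite G]
    (hG : ¬ p ∣ Nat.card G) : IsAmenableRing (Ainf p G) := by
  have (m : MaximalSpectrum (MonoidAlgebra (ZMod p) G)) : UniqueFactorizationMonoid
      (MvPowerSeries ℕ (WittVector p (groupRingResidueField p G m))) :=
    ufd_mvPowerSeries_nat _
  exact isAmenableRing_of_ringEquiv_pi ((groupRingEquiv ℕ ℤ_[p] G).trans
    (mvPowerSeriesPiEquiv ℕ (groupRingWittEquiv p G hG)))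

/-! ### The coefficientwise topology on group rings. -/

section CoefficientTopology

variable {σ S : Type*} [CommRing S] {G : Type*}

/-- The coefficients of the elements `X^d g` in a group ring over a power series ring. -/
def groupRingCoeff (a : MonoidAlgebra (MvPowerSeries σ S) G) (x : G × (σ →₀ ℕ)) : S :=
  MvPowerSeries.coeff x.2 (a.coeff x.1)

theorem continuous_groupRingCoeff [TopologicalSpace S] (x : G × (σ →₀ ℕ)) :
    @Continuous _ _ (TopologicalSpace.induced groupRingCoeff Pi.topologicalSpace) _
      (fun a : MonoidAlgebra (MvPowerSeries σ S) G => groupRingCoeff a x) := by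
  let t : TopologicalSpace (MonoidAlgebra (MvPowerSeries σ S) G) :=
    TopologicalSpace.induced groupRingCoeff Pi.topologicalSpace
  have h : Continuous (groupRingCoeff (σ := σ) (S := S) (G := G)) := continuous_induced_dom
  exact (continuous_apply x).comp h

variable [CommGroup G]

variable (σ S G) in
/-- An element of the group ring of a finite group over a power series ring is the same as a family
of coefficients. -/
def groupRingCoeffEquiv [Finite G] :
    MonoidAlgebra (MvPowerSeries σ S) G ≃+ (G × (σ →₀ ℕ) → S) where
  toFun := groupRingCoeff
  invFun c := .ofCoeff (Finsupp.equivFunOnFinite.symm fun g d => c (g, d))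
  left_inv a := by ext; rfl
  right_inv c := rfl
  map_add' a b := rfl

theorem groupRingCoeff_mul [Fintype G] [DecidableEq σ] (a b : MonoidAlgebra (MvPowerSeries σ S) G)
    (x : G × (σ →₀ ℕ)) : groupRingCoeff (a * b) x = ∑ h : G,
      ∑ d ∈ Finset.HasAntidiagonal.antidiagonal x.2,
        groupRingCoeff a (h, d.1) * groupRingCoeff b (h⁻¹ * x.1, d.2) := by
  rw [groupRingCoeff, MonoidAlgebra.coeff_mul_apply_left, Finsupp.sum_fintype _ _ (by simp),
    map_sum]
  exact Finset.sum_congr rfl fun h _ => MvPowerSeries.coeff_mul _ _ _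

/-- The space is a product of copies of `S`, compact by Tychonoff, and each coefficient of a product
is a finite polynomial expression in the coefficients of the factors. -/
theorem isCompactRingTopology_induced_groupRingCoeff [Finite G] [TopologicalSpace S]
    [IsTopologicalRing S] [CompactSpace S] [T2Space S] :
    IsCompactRingTopology (MonoidAlgebra (MvPowerSeries σ S) G)
      (TopologicalSpace.induced groupRingCoeff Pi.topologicalSpace) := by
  classical
  have := Fintype.ofFinite G
  let t : TopologicalSpace (MonoidAlgebra (MvPowerSeries σ S) G) :=
    TopologicalSpace.induced groupRingCoeff Pi.topologicalSpace
  have hc : ∀ x, Continuous fun a : MonoidAlgebra (MvPowerSeries σ S) G => groupRingCoeff a x :=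
    continuous_groupRingCoeff
  let e : MonoidAlgebra (MvPowerSeries σ S) G ≃ₜ (G × (σ →₀ ℕ) → S) :=
    (groupRingCoeffEquiv σ S G).toEquiv.toHomeomorphOfIsInducing ⟨rfl⟩
  refine ⟨?_, e.symm.compactSpace, e.symm.t2Space⟩
  have : ContinuousAdd (MonoidAlgebra (MvPowerSeries σ S) G) :=
    ⟨continuous_induced_rng.2 (continuous_pi fun x =>
      ((hc x).comp continuous_fst).add ((hc x).comp continuous_snd))⟩
  have : ContinuousNeg (MonoidAlgebra (MvPowerSeries σ S) G) :=
    ⟨continuous_induced_rng.2 (continuous_pi fun x => (hc x).neg)⟩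
  have : ContinuousMul (MonoidAlgebra (MvPowerSeries σ S) G) := by
    refine ⟨continuous_induced_rng.2 (continuous_pi fun x => ?_)⟩
    simp only [Function.comp_apply, groupRingCoeff_mul]
    exact continuous_finsetSum _ fun h _ => continuous_finsetSum _ fun d _ =>
      ((hc _).comp continuous_fst).mul ((hc _).comp continuous_snd)
  exact {}

theorem isAdicComplete_groupRing_mvPowerSeries (p : ℕ) [IsAdicComplete (Ideal.span {(p : S)}) S]
    [Finite G] : IsPAdicallyComplete p (MonoidAlgebra (MvPowerSeries σ S) G) :=
  isAdicComplete_span_natCast_of_addEquiv p (groupRingCoeffEquiv σ S G)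

theorem isAdicComplete_mvPowerSeries (p : ℕ) [IsAdicComplete (Ideal.span {(p : S)}) S] :
    IsPAdicallyComplete p (MvPowerSeries σ S) :=
  isAdicComplete_span_natCast_of_addEquiv (ι := σ →₀ ℕ) p (AddEquiv.refl _)

end CoefficientTopology

/-! ### `A` as a compact inverse limit, and the amenability criterion. -/

section Limit

variable (p : ℕ) [Fact p.Prime] (G : Type u) [CommGroup G]

theorem groupRingCoeff_projA (n : ℕ) (a : Ainf p G) (x : G × (Fin n →₀ ℕ)) :
    groupRingCoeff (projA p G n a) x =
      groupRingCoeff a (x.1, x.2.embDomain Fin.valEmbedding) := by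
  rw [groupRingCoeff, projA, MonoidAlgebra.coeff_mapRingHom]
  exact MvPowerSeries.coeff_killCompl _ _

theorem groupRingCoeff_transA (n : ℕ) (a : Afin p G (n + 1)) (x : G × (Fin n →₀ ℕ)) :
    groupRingCoeff (transA p G n a) x =
      groupRingCoeff a (x.1, x.2.embDomain Fin.castSuccEmb) := by
  rw [groupRingCoeff, transA, MonoidAlgebra.coeff_mapRingHom]
  exact MvPowerSeries.coeff_killCompl _ _

theorem exists_groupRingCoeff_projA (y : G × (ℕ →₀ ℕ)) : ∃ (n : ℕ) (x : G × (Fin n →₀ ℕ)),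
    ∀ a : Ainf p G, groupRingCoeff (projA p G n a) x = groupRingCoeff a y := by
  obtain ⟨N, hN⟩ := y.2.support.bddAbove
  obtain ⟨x, hx⟩ := (Finsupp.mem_range_embDomain_iff (Fin.valEmbedding : Fin (N + 1) ↪ ℕ) y.2).2
    fun i hi => ⟨⟨i, Nat.lt_succ_of_le (hN hi)⟩, rfl⟩
  exact ⟨N + 1, (y.1, x), fun a => by rw [groupRingCoeff_projA, hx]⟩

theorem continuous_transA (n : ℕ) : @Continuous _ _ (topA p G (n + 1)) (topA p G n)
    (transA p G n) := by
  let t := topA p G (n + 1)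
  refine continuous_induced_rng.2 (continuous_pi fun x => ?_)
  exact (continuous_groupRingCoeff (x.1, x.2.embDomain Fin.castSuccEmb)).congr
    fun a => (groupRingCoeff_transA p G n a x).symm

/-- A monomial involves finitely many variables, so every coefficient of an element of `A` is
already a coefficient of its image in some `A_n`. -/
theorem limitTopology_eq_induced : limitTopology (topA p G) (projA p G) =
    TopologicalSpace.induced groupRingCoeff Pi.topologicalSpace := by
  refine le_antisymm ?_ (le_iInf fun n => ?_)
  · let t₀ := limitTopology (topA p G) (projA p G)
    refine continuous_iff_le_induced.1 (continuous_pi fun y => ?_)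
    obtain ⟨n, x, h⟩ := exists_groupRingCoeff_projA p G y
    refine continuous_iInf_dom (i := n) ?_
    let t := topA p G n
    let t' := TopologicalSpace.induced (projA p G n) t
    have hπ : Continuous (projA p G n) := continuous_induced_dom
    exact ((continuous_groupRingCoeff x).comp hπ).congr h
  · rw [← continuous_iff_le_induced]
    let t : TopologicalSpace (Ainf p G) :=
      TopologicalSpace.induced groupRingCoeff Pi.topologicalSpace
    refine continuous_induced_rng.2 (continuous_pi fun x => ?_)
    exact (continuous_groupRingCoeff (x.1, x.2.embDomain Fin.valEmbedding)).congr
      fun a => (groupRingCoeff_projA p G n a x).symm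

theorem isInverseLimit_monoidAlgebra [Finite G] {B : ℕ → Type v} [∀ n, CommRing (B n)]
    {A : Type*} [CommRing A] {φ : ∀ n, B (n + 1) →+* B n} {π : ∀ n, A →+* B n}
    (h : IsInverseLimit φ π) :
    IsInverseLimit (fun n => MonoidAlgebra.mapRingHom G (φ n))
      (fun n => MonoidAlgebra.mapRingHom G (π n)) := by
  refine ⟨fun n => RingHom.ext fun a => MonoidAlgebra.ext (Finsupp.ext fun g => ?_), fun b hb => ?_⟩
  · simp only [RingHom.comp_apply, MonoidAlgebra.coeff_mapRingHom]
    exact RingHom.congr_fun (h.compatible n) _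
  · have hlift : ∀ g, ∃! a : A, ∀ n, π n a = (b n).coeff g := fun g =>
      h.existsUnique_lift _ fun n => by rw [← hb n, MonoidAlgebra.coeff_mapRingHom]
    choose a ha hu using hlift
    refine ⟨.ofCoeff (Finsupp.equivFunOnFinite.symm a), fun n => ?_, fun a' ha' => ?_⟩
    · refine MonoidAlgebra.ext (Finsupp.ext fun g => ?_)
      rw [MonoidAlgebra.coeff_mapRingHom]
      exact ha g n
    · refine MonoidAlgebra.ext (Finsupp.ext fun g => hu g _ fun n => ?_)
      rw [← ha' n, MonoidAlgebra.coeff_mapRingHom]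

theorem transA_surjective [Finite G] (n : ℕ) : Function.Surjective (transA p G n) := by
  intro b
  refine ⟨MonoidAlgebra.mapRingHom G
    (MvPowerSeries.rename (R := ℤ_[p]) (Fin.castSuccEmb : Fin n ↪ Fin (n + 1))).toRingHom b,
    MonoidAlgebra.ext (Finsupp.ext fun g => ?_)⟩
  rw [transA, MonoidAlgebra.coeff_mapRingHom, MonoidAlgebra.coeff_mapRingHom]
  exact MvPowerSeries.killCompl_rename_app _

theorem isCompactInverseLimit_Ainf [Finite G] :
    IsCompactInverseLimit (topA p G) (transA p G) (projA p G) where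
  isInverseLimit := isInverseLimit_monoidAlgebra G (isInverseLimit_Rinf p)
  surjective := transA_surjective p G
  compact _ := isCompactRingTopology_induced_groupRingCoeff
  continuous := continuous_transA p G
  compact_limit := by
    rw [limitTopology_eq_induced]
    exact isCompactRingTopology_induced_groupRingCoeff
  isClosed_ker n := by
    let t := topA p G n
    let t' := limitTopology (topA p G) (projA p G)
    have : T2Space (Afin p G n) := isCompactRingTopology_induced_groupRingCoeff.t2Space
    have h : Continuous (projA p G n) := continuous_iInf_dom (i := n) continuous_induced_dom
    exact isClosed_singleton.preimage h

theorem isAmenableRing_Ainf_iff [Finite G] : IsAmenableRing (Ainf p G) ↔ ¬ p ∣ Nat.card G := by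
  refine ⟨fun h hG => ?_, isAmenableRing_Ainf p G⟩
  have : IsDomain (Rinf p) := isDomain_mvPowerSeries ℤ_[p] ℕ
  have : UniqueFactorizationMonoid (Rinf p) := ufd_mvPowerSeries_nat ℤ_[p]
  have hp : Prime (p : Rinf p) := by
    rw [← map_natCast (MvPowerSeries.C (σ := ℕ) (R := ℤ_[p]))]
    exact prime_C PadicInt.prime_p
  exact not_isAmenableRing_monoidAlgebra hp hG h

end Limit

end IwasawaLemma

end

open IwasawaLemma in
theorem mainTheorem7 (p : ℕ) [Fact p.Prime] (G : Type*) [CommGroup G] [Finite G] :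
    -- (i) for `R` and for every `R_n`
    (IsPAdicallyComplete p (Rinf p) ∧ IsDomain (Rinf p) ∧
      UniqueFactorizationMonoid (Rinf p) ∧ IsAmenableRing (Rinf p)) ∧
    (∀ n : ℕ, IsPAdicallyComplete p (Rfin p n) ∧ IsDomain (Rfin p n) ∧
      UniqueFactorizationMonoid (Rfin p n) ∧ IsAmenableRing (Rfin p n)) ∧
    -- (ii)
    IsPAdicallyComplete p (Ainf p G) ∧
    IsCompactInverseLimit (topA p G) (transA p G) (projA p G) ∧
    (IsAmenableRing (Ainf p G) ↔ ¬ p ∣ Nat.card G) ∧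
    -- (iii)
    (∀ (n : ℕ) (P : Ideal (Afin p G n)), P.IsPrime → (P.map (inclA p G n)).IsPrime) := by
  have hR : UniqueFactorizationMonoid (Rinf p) := ufd_mvPowerSeries_nat ℤ_[p]
  have hRn (n : ℕ) : UniqueFactorizationMonoid (Rfin p n) := ufd_mvPowerSeries_fin ℤ_[p] n
  have hD (σ : Type) : IsDomain (MvPowerSeries σ ℤ_[p]) := isDomain_mvPowerSeries ℤ_[p] σ
  exact ⟨⟨isAdicComplete_mvPowerSeries p, hD ℕ, hR, isAmenableRing_of_ufd _⟩,
    fun n => ⟨isAdicComplete_mvPowerSeries p, hD (Fin n), hRn n, isAmenableRing_of_ufd _⟩,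
    isAdicComplete_groupRing_mvPowerSeries p, isCompactInverseLimit_Ainf p G,
    isAmenableRing_Ainf_iff p G, fun n P _ => isPrime_map_inclA p G n P⟩
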